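/- All graphs are finite, undirected and simple. Let $G$ be a graph. An edge of $G$ is \emph{allowed} if it lies in some maximum matching of $G$. A \emph{factor-component} of $G$ is a subgraph of $G$ induced by the vertex set of a connected component of the spanning subgraph of $G$ formed by all allowed edges; $\mathcal{G}(G)$ denotes the set of factor-components. A graph $H$ is \emph{factor-critical} if for every vertex $v$ of $H$ there is a matching of $H$ covering exactly the vertices other than $v$. \emph{Basilica order.} A set $X\subseteq V(G)$ is \emph{separating} if it is the union of the vertex sets of at least one factor-component. For $G_1,G_2\in\mathcal{G}(G)$ write $G_1\preceq G_2$ if there is a separating set $X$ with $V(G_1)\cup V(G_2)\subseteq X$ such that the graph $G[X]/G_1$, obtained from the induced subgraph $G[X]$ by contracting $V(G_1)$ to a single vertex (parallel edges being irrelevant), is factor-critical. For $G_0\in\mathcal{G}(G)$ let $U(G_0)$ be the union of the vertex sets $V(H)$ over all $H\in\mathcal{G}(G)$ with $G_0\preceq H$ and $H\neq G_0$. \emph{Generalized Kotzig--Lovász partition.} Let $\operatorname{def}(G)=|V(G)|-2\nu(G)$, where $\nu(G)$ is the size of a maximum matching. For $u,v\in V(G)$ write $u\sim_G v$ if $u=v$,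 or if $u$ and $v$ lie in the same factor-component of $G$ and $\operatorname{def}(G-u-v)>\operatorname{def}(G)$. The members of the generalized Kotzig--Lovász partition $\mathcal{P}_G(G_0)$ of $G_0\in\mathcal{G}(G)$ are the classes $\{v\in V(G): u\sim_G v\}$ with $u\in V(G_0)$. \textbf{Theorem.} Let $G$ be a graph and let $G_0\in\mathcal{G}(G)$. For each connected component $K$ of the induced subgraph $G[U(G_0)]$ there exists $T_K\in\mathcal{P}_G(G_0)$ such that $$N_G(K)\cap V(G_0)\subseteq T_K,$$ where $N_G(K)$ is the set of vertices outside $K$ that are adjacent to a vertex of $K$. -/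

import Mathlib

namespace Basilica

variable {V : Type*}

/-- A maximum matching: a matching with the greatest number of edges. -/
def IsMaximumMatching (G : SimpleGraph V) (M : G.Subgraph) : Prop :=
  M.IsMatching ∧ ∀ N : G.Subgraph, N.IsMatching → N.edgeSet.ncard ≤ M.edgeSet.ncard

/-- The spanning subgraph of `G` whose edges are the allowed edges of `G`, that is, the edges
contained in some maximum matching. -/
def allowedGraph (G : SimpleGraph V) : SimpleGraph V where
  Adj u v := ∃ M : G.Subgraph, IsMaximumMatching G M ∧ M.Adj u v
  symm := ⟨fun _ _ ⟨M, hM, h⟩ => ⟨M, hM, h.symm⟩⟩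
  loopless := ⟨fun _ ⟨M, _, h⟩ => G.loopless.irrefl _ (M.adj_sub h)⟩

/-- A factor-component of `G` is the subgraph of `G` induced by a connected component `H` of
`allowedGraph G`. It is represented by `H`; its vertex set is `H.supp`. -/
abbrev FactorComponent (G : SimpleGraph V) := (allowedGraph G).ConnectedComponent

/-- A separating set: the union of the vertex sets of at least one factor-component. -/
def IsSeparating (G : SimpleGraph V) (X : Set V) : Prop :=
  ∃ S : Set (FactorComponent G), S.Nonempty ∧ X = ⋃ H ∈ S, H.supp

/-- A graph is factor-critical if for every vertex `v` there is a matching that covers exactly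
the vertices other than `v`. -/
def IsFactorCritical (G : SimpleGraph V) : Prop :=
  ∀ v : V, ∃ M : G.Subgraph, M.IsMatching ∧ M.verts = {v}ᶜ

/-- The contraction `G / X`, up to parallel edges: the vertex `none` replaces all of `X`. -/
def contract (G : SimpleGraph V) (X : Set V) : SimpleGraph (Option ↥(Xᶜ)) where
  Adj a b :=
    match a, b with
    | none, none => False
    | none, some v => ∃ x ∈ X, G.Adj x v
    | some u, none => ∃ x ∈ X, G.Adj x u
    | some u, some v => G.Adj u v
  symm := ⟨by
    rintro (_ | u) (_ | v) h
    · exact h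
    · exact h
    · exact h
    · exact SimpleGraph.Adj.symm h⟩
  loopless := ⟨by
    rintro (_ | u) h
    · exact h
    · exact G.loopless.irrefl _ h⟩

/-- `X` is a critical-inducing set for `H`: it is separating, contains `V(H)`, and `G[X] / H` is
factor-critical. -/
def IsCriticalInducing (G : SimpleGraph V) (H : FactorComponent G) (X : Set V) : Prop :=
  IsSeparating G X ∧ H.supp ⊆ X ∧
    IsFactorCritical (contract (G.induce X) ((Subtype.val : ↥X → V) ⁻¹' H.supp))

/-- The basilica order on the factor-components: `H ≤ H'` if some critical-inducing set for `H`
contains `V(H')`. -/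
def BasilicaLE (G : SimpleGraph V) (H H' : FactorComponent G) : Prop :=
  ∃ X : Set V, IsCriticalInducing G H X ∧ H'.supp ⊆ X

/-- The vertices contained in the strict upper bounds of `H` in the basilica order. -/
def strictUpperVerts (G : SimpleGraph V) (H : FactorComponent G) : Set V :=
  ⋃ H' ∈ {H' : FactorComponent G | BasilicaLE G H H' ∧ H' ≠ H}, H'.supp

/-- The number of edges of a maximum matching (meant for finite graphs). -/
noncomputable def matchingNumber (G : SimpleGraph V) : ℕ :=
  sSup {n : ℕ | ∃ M : G.Subgraph, M.IsMatching ∧ M.edgeSet.ncard = n}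

/-- The deficiency `|V(G)| - 2 ν(G)` (meant for finite graphs). -/
noncomputable def deficiency (G : SimpleGraph V) : ℤ :=
  (Nat.card V : ℤ) - 2 * (matchingNumber G : ℤ)

/-- The relation `u ∼ v`: either `u = v`, or `u` and `v` lie in the same factor-component and
deleting both of them increases the deficiency. -/
def GKLRel (G : SimpleGraph V) (u v : V) : Prop :=
  u = v ∨ ((allowedGraph G).connectedComponentMk u = (allowedGraph G).connectedComponentMk v ∧
    deficiency G < deficiency (G.induce ({u, v} : Set V)ᶜ))

/-- The generalized Kotzig–Lovász partition of the factor-component `H`: the classes of the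
relation `GKLRel G` on `V(H)`. -/
def gklPartition (G : SimpleGraph V) (H : FactorComponent G) : Set (Set V) :=
  {T | ∃ u ∈ H.supp, T = {v | GKLRel G u v}}

/-- The set of neighbours of `X`: the vertices outside `X` adjacent to a vertex of `X`. -/
def neighbours (G : SimpleGraph V) (X : Set V) : Set V :=
  {v | v ∉ X ∧ ∃ x ∈ X, G.Adj x v}

end Basilica

/-!
The proof rests on the exchange property of matchings (`IsMate.exchange`): the vertex sets covered
by matchings of a finite graph form an even delta-matroid. All arguments about alternating paths are
replaced by applications of it.

*Graphs with a perfect matching.* Let `M` be a perfect matching and `W₀` a component of the graph of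
allowed edges. Call a set `B` outside `W₀` critical if `M` preserves it and contracting `W₀` in the
subgraph induced by `B ∪ W₀` gives a factor-critical graph (`IsCrit`). Critical sets are closed
under unions, so there is a largest one, which contains all strict upper bounds of `W₀` in the
basilica order. By maximality it has no ear through its outside (`not_exists_ear`); hence every
perfect matching, and even every matching that covers everything outside, preserves the outside
(`IsMate.mapsTo_critCompl`).

Let `K` be a connected component of the subgraph induced by the largest critical set, and suppose
that `u` and `v` in `W₀` are adjacent to `K` while some matching misses `u` and `v` only. This
matching may run through `K`, but an exchange in the complement `Kᶜ` gives a vertex `s` of `W₀`,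
again adjacent to `K`, such that `Kᶜ \ {u, s}` has a perfect matching. On the other hand, if `K` is
matched up to two vertices adjacent to `x` and to `y` in `W₀`, then `Kᶜ \ {x, y}` has no perfect
matching, as otherwise an edge between `W₀` and `K` would be allowed. By Gallai's lemma, applied to
`K` together with two new vertices (`exists_matchable_diff`), these pairs `x`, `y` connect all
neighbours of `K` in `W₀`, and having no perfect matching of `Kᶜ \ {x, y}` is a transitive relation
on `W₀` (`not_matchable_trans`, the Kotzig–Lovász theorem). So `Kᶜ \ {u, s}` has no perfect
matching, a contradiction (`not_matchable_of_reachable`).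

*General graphs.* Joining `def(G)` new independent vertices to all vertices of `G` gives a graph
with a perfect matching. Each factor-component of `G` lies in one of this `extension`, and
critical-inducing sets of `G` remain critical there (`IsCriticalInducing.isCrit`), since their part
outside the given factor-component is covered by every maximum matching of `G`. If deleting `u` and
`v` does not increase the deficiency of `G`, it leaves a perfect matching in the extension
(`matchable_of_deficiency_le`), and the first case applies.
-/

namespace Basilica

/-! ### Matchings as involutions and the exchange property -/

section Exchange

variable {W : Type*} {Γ : SimpleGraph W}

/-- A matching of `Γ`, encoded as an involution of the vertex set that moves every vertex to
itself or to a neighbour. The fixed points are the vertices that the matching misses. -/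
def IsMate (Γ : SimpleGraph W) (f : W → W) : Prop :=
  ∀ x, f (f x) = x ∧ (f x = x ∨ Γ.Adj x (f x))

/-- `S` is matchable if some matching of `Γ` covers exactly the vertices of `S`. -/
def Matchable (Γ : SimpleGraph W) (S : Set W) : Prop :=
  ∃ f, IsMate Γ f ∧ ∀ x, f x ≠ x ↔ x ∈ S

open Classical in
theorem IsMate.addEdge {f : W → W} (hf : IsMate Γ f) {a b : W} (hab : Γ.Adj a b)
    (ha : f a = a) (hb : f b = b) :
    IsMate Γ (fun x ↦ if x = a then b else if x = b then a else f x) := by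
  have hne := hab.ne
  have hba := hab.symm
  intro x
  have h1 := hf x
  refine ⟨?_, ?_⟩ <;> grind

open Classical in
theorem IsMate.removeEdge {f : W → W} (hf : IsMate Γ f) (a : W) :
    IsMate Γ (fun x ↦ if x = a then a else if x = f a then f a else f x) := by
  intro x
  have h1 := hf x
  have h2 := hf a
  refine ⟨?_, ?_⟩ <;> grind

open Classical in
theorem IsMate.restrict {f : W → W} (hf : IsMate Γ f) (S : Set W) :
    IsMate Γ (fun x ↦ if x ∈ S ∧ f x ∈ S then f x else x) := by
  intro x
  have h1 := hf x
  refine ⟨?_, ?_⟩ <;> grind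

/-- A symmetric, functional relation contained in the adjacency relation is a matching. -/
theorem exists_isMate_of_rel (r : W → W → Prop) (hs : ∀ a b, r a b → r b a)
    (hadj : ∀ a b, r a b → Γ.Adj a b) (hu : ∀ a b c, r a b → r a c → b = c) :
    ∃ f, IsMate Γ f ∧ (∀ a b, r a b → f a = b) ∧ ∀ a, f a ≠ a ↔ ∃ b, r a b := by
  classical
  have key : ∀ a (h : ∃ b, r a b), r a h.choose := fun a h ↦ h.choose_spec
  refine ⟨fun x ↦ if h : ∃ b, r x b then h.choose else x, fun x ↦ ?_, fun a b hab ↦ ?_,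
    fun x ↦ ?_⟩
  · by_cases h : ∃ b, r x b
    · have h1 := key x h
      have h2 : ∃ b, r h.choose b := ⟨x, hs _ _ h1⟩
      simp only [h, dite_true, h2]
      exact ⟨hu _ _ _ (key _ h2) (hs _ _ h1), Or.inr (hadj _ _ h1)⟩
    · simp [h]
  · have h : ∃ b, r a b := ⟨b, hab⟩
    simp only [h, dite_true]
    exact hu _ _ _ (key a h) hab
  · by_cases h : ∃ b, r x b
    · simp only [h, dite_true, iff_true]
      exact (hadj _ _ (key x h)).ne'
    · simp [h]

theorem Matchable.of_rel (r : W → W → Prop) (hs : ∀ a b, r a b → r b a)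
    (hadj : ∀ a b, r a b → Γ.Adj a b) (hu : ∀ a b c, r a b → r a c → b = c) {S : Set W}
    (hS : ∀ a, a ∈ S ↔ ∃ b, r a b) : Matchable Γ S := by
  obtain ⟨f, hf, -, hfS⟩ := exists_isMate_of_rel r hs hadj hu
  exact ⟨f, hf, fun x ↦ (hfS x).trans (hS x).symm⟩

theorem Matchable.union {S T : Set W} (hS : Matchable Γ S) (hT : Matchable Γ T)
    (hd : ∀ x ∈ S, x ∉ T) : Matchable Γ (S ∪ T) := by
  classical
  obtain ⟨f, hf, hfS⟩ := hS
  obtain ⟨g, hg, hgT⟩ := hT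
  refine ⟨fun x ↦ if x ∈ S then f x else g x, fun x ↦ ?_, fun x ↦ ?_⟩
  · have h1 := hf x
    have h2 := hg x
    have h3 := hfS x
    have h4 := hfS (f x)
    have h5 := hgT x
    have h6 := hgT (g x)
    have h7 := hd (g x)
    have h8 := hd x
    by_cases hx : x ∈ S
    · have : f x ∈ S := h4.1 (by rw [h1.1]; exact (h3.2 hx).symm)
      simpa [hx, this] using h1
    · have : g x ∉ S := by
        intro h
        have := h7 h
        rw [← h6, h2.1] at this
        push Not at this
        exact hx (this ▸ h)
      simpa [hx, this] using h2
  · have h3 := hfS x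
    have h5 := hgT x
    have h8 := hd x
    by_cases hx : x ∈ S <;> simp [hx] <;> grind

theorem Matchable.addEdge {S : Set W} (hS : Matchable Γ S) {a b : W} (hab : Γ.Adj a b)
    (ha : a ∉ S) (hb : b ∉ S) : Matchable Γ (S ∪ {a, b}) := by
  obtain ⟨f, hf, hfS⟩ := hS
  have h1 := hfS a
  have h2 := hfS b
  refine ⟨_, hf.addEdge hab (by tauto) (by tauto), fun x ↦ ?_⟩
  have h3 := hfS x
  have := hab.ne
  simp only [Set.mem_union, Set.mem_insert_iff, Set.mem_singleton_iff]
  grind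

/-- A matching restricted to a set that it preserves. -/
theorem IsMate.matchable_of_mapsTo {f : W → W} (hf : IsMate Γ f) {S T : Set W}
    (hS : ∀ x ∈ S, f x ∈ S) (hT : ∀ x, x ∈ T ↔ x ∈ S ∧ f x ≠ x) : Matchable Γ T := by
  classical
  refine ⟨_, hf.restrict S, fun x ↦ ?_⟩
  have := hS x
  have := hT x
  grind

theorem IsMate.matchable_diff_edge {f : W → W} (hf : IsMate Γ f) {S : Set W}
    (hS : ∀ x, f x ≠ x ↔ x ∈ S) (a : W) : Matchable Γ (S \ {a, f a}) := by
  classical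
  refine ⟨_, hf.removeEdge a, fun x ↦ ?_⟩
  have := hS x
  simp only [Set.mem_sdiff, Set.mem_insert_iff, Set.mem_singleton_iff]
  grind

/-- The exchange step when `f` covers `e` and `g` does not. The vertex `e` is rematched as in `f`;
if this uncovers a vertex that `f` covers, the exchange continues from there, and the new matching
agrees with `f` on more vertices than `g` did. -/
theorem IsMate.exchange_of_fixed [Finite W] {f g : W → W} (hf : IsMate Γ f) (hg : IsMate Γ g)
    {e : W} (hfe : f e ≠ e) (hge : g e = e) :
    ∃ e' h, e' ≠ e ∧ IsMate Γ h ∧ ¬ (f e' = e' ↔ g e' = e') ∧ (∀ x, h x = f x ∨ h x = g x) ∧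
      (h e = e ↔ f e = e) ∧ (h e' = e' ↔ f e' = e') ∧
      ∀ x, x ≠ e → x ≠ e' → (h x = x ↔ g x = x) := by
  classical
  induction hn : {x | f x ≠ g x}.ncard using Nat.strong_induction_on generalizing g e with
  | _ n ih =>
  have hadj : Γ.Adj e (f e) := (hf e).2.resolve_left hfe
  have hffe := (hf e).1
  by_cases hga : g (f e) = f e
  · refine ⟨f e, _, hfe, hg.addEdge hadj hge hga, ?_, fun x ↦ ?_, ?_, ?_, fun x hx hx' ↦ ?_⟩ <;>
      grind
  · set a := f e with ha
    set b := g a with hb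
    have hgb : g b = a := (hg a).1
    have hba : b ≠ a := hga
    have hbe : b ≠ e := by grind
    -- `g'` is `g` with the edge `ab` replaced by `ea`
    obtain ⟨g', hg', hg'def⟩ : ∃ g', IsMate Γ g' ∧
        ∀ x, g' x = if x = e then a else if x = a then e else if x = b then b else g x := by
      refine ⟨_, (hg.removeEdge a).addEdge hadj (by grind) (by grind), fun x ↦ ?_⟩
      grind
    by_cases hfb : f b = b
    · refine ⟨b, g', hbe, hg', ?_, fun x ↦ ?_, ?_, ?_, fun x hx hx' ↦ ?_⟩ <;> grind
    · have hlt : {x | f x ≠ g' x}.ncard < n := by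
        clear ih
        rw [← hn]
        refine Set.ncard_lt_ncard ⟨fun x hx ↦ ?_, fun h ↦ ?_⟩ (Set.toFinite _)
        · simp only [Set.mem_ofPred_eq] at hx ⊢
          have := (hf b).1
          have := hg'def x
          clear hn
          grind
        · have h1 : e ∈ {x | f x ≠ g' x} := h (by simp only [Set.mem_ofPred_eq]; grind)
          simp only [Set.mem_ofPred_eq] at h1
          have := hg'def e
          clear h hn
          grind
      obtain ⟨e', h, h1, h2, h3, h4, h5, h6, h7⟩ := ih _ hlt hg' hfb (by grind) rfl
      clear ih hlt hn
      refine ⟨e', h, ?_, h2, ?_, fun x ↦ ?_, ?_, h6, fun x hx hx' ↦ ?_⟩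
      · grind
      · grind
      · have := h4 x
        grind
      · have := h7 e
        grind
      · have := h7 x
        grind

/-- The exchange property of matchings: the vertex sets covered by matchings form an even
delta-matroid. If exactly one of `f` and `g` covers `e`, then the status of `e` in `g`, together
with that of one further vertex `e'`, can be changed to their status in `f`, by a matching
contained in the union of `f` and `g`. -/
theorem IsMate.exchange [Finite W] {f g : W → W} (hf : IsMate Γ f) (hg : IsMate Γ g)
    {e : W} (he : ¬ (f e = e ↔ g e = e)) :
    ∃ e' h, e' ≠ e ∧ IsMate Γ h ∧ ¬ (f e' = e' ↔ g e' = e') ∧ (∀ x, h x = f x ∨ h x = g x) ∧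
      (h e = e ↔ f e = e) ∧ (h e' = e' ↔ f e' = e') ∧
      ∀ x, x ≠ e → x ≠ e' → (h x = x ↔ g x = x) := by
  classical
  by_cases hfe : f e = e
  · have hge : g e ≠ e := by tauto
    obtain ⟨g', hg', hg'def⟩ : ∃ g', IsMate Γ g' ∧
        ∀ x, g' x = if x = e then e else if x = g e then g e else g x :=
      ⟨_, hg.removeEdge e, fun _ ↦ rfl⟩
    have hgg := (hg e).1
    by_cases hfa : f (g e) = g e
    · refine ⟨g e, g', hge, hg', ?_, fun x ↦ ?_, ?_, ?_, fun x hx hx' ↦ ?_⟩ <;> grind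
    · obtain ⟨e', h, h1, h2, h3, h4, h5, h6, h7⟩ :=
        hf.exchange_of_fixed hg' hfa (by grind)
      have he' : e' ≠ e := by grind
      refine ⟨e', h, he', h2, ?_, fun x ↦ ?_, ?_, h6, fun x hx hx' ↦ ?_⟩
      · grind
      · have := h4 x
        have := h7 e
        grind
      · have := h7 e
        grind
      · have := h7 x
        grind
  · exact hf.exchange_of_fixed hg hfe (by tauto)

end Exchange

/-! ### The Kotzig–Lovász relation and Gallai's lemma -/

section Gallai

variable {W : Type*} {Γ : SimpleGraph W}

theorem Matchable.congr {S T : Set W} (hS : Matchable Γ S) (h : ∀ x, x ∈ S ↔ x ∈ T) :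
    Matchable Γ T := by
  rwa [← Set.ext h]

/-- The exchange property stated for matchable sets: the membership of `e` and of some further
`e'` in `F'` can be changed to their membership in `F`. -/
theorem Matchable.exchange [Finite W] {F F' : Set W} (hF : Matchable Γ F) (hF' : Matchable Γ F')
    {e : W} (he : ¬ (e ∈ F ↔ e ∈ F')) :
    ∃ e', e' ≠ e ∧ ¬ (e' ∈ F ↔ e' ∈ F') ∧
      Matchable Γ {x | ((x = e ∨ x = e') ∧ x ∈ F) ∨ (x ≠ e ∧ x ≠ e' ∧ x ∈ F')} := by
  obtain ⟨f, hf, hfF⟩ := hF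
  obtain ⟨g, hg, hgF⟩ := hF'
  simp only [← hfF, ← hgF] at he ⊢
  obtain ⟨e', h, h1, h2, h3, -, h5, h6, h7⟩ := hf.exchange hg (e := e) (by grind)
  refine ⟨e', h1, by grind, h, h2, fun x ↦ ?_⟩
  have := h7 x
  simp only [Set.mem_ofPred_eq]
  clear hfF hgF h7
  by_cases x = e <;> by_cases x = e' <;> grind

/-- Let `D` be the set of vertices `d` for which `A \ {x, d}` is matchable, as in the Gallai–Edmonds
decomposition of the graph on `A \ {x}`. If `a` and `c` lie outside `D`, and `a` has a neighbour in
`D`, then `A \ {a, c}` is not matchable. -/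
theorem not_matchable_of_adj [Finite W] {A : Set W} {x a c d : W} (hx : x ∈ A) (ha : a ∈ A)
    (hd : d ∈ A) (hda : Γ.Adj d a) (hax : a ≠ x) (hcx : c ≠ x) (hac : a ≠ c)
    (hxd : Matchable Γ (A \ {x, d})) (hxa : ¬ Matchable Γ (A \ {x, a}))
    (hxc : ¬ Matchable Γ (A \ {x, c})) : ¬ Matchable Γ (A \ {a, c}) := by
  intro hm
  have hda' := hda.ne
  have hdc : d ≠ c := by rintro rfl; exact hxc hxd
  obtain ⟨e', h1, h2, h3⟩ := hxd.exchange hm (e := x) (by grind)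
  have h4 : e' = d ∨ e' = a ∨ e' = c := by grind
  rcases h4 with rfl | rfl | rfl
  · have h5 : Matchable Γ (A \ {x, e', a, c}) := h3.congr (by grind)
    refine hxc ((h5.addEdge hda (by grind) (by grind)).congr (by grind))
  · exact hxc (h3.congr (by grind))
  · exact hxa (h3.congr (by grind))

/-- An edge of `Γ` that lies in a perfect matching of the subgraph induced by `A`. -/
def IsAllowed (Γ : SimpleGraph W) (A : Set W) (a b : W) : Prop :=
  a ∈ A ∧ b ∈ A ∧ Γ.Adj a b ∧ Matchable Γ (A \ {a, b})

/-- Transitivity of the Kotzig–Lovász relation in a graph with a perfect matching: within a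
component of the graph of allowed edges, the pairs of vertices whose deletion destroys perfect
matchability form an equivalence relation. -/
theorem not_matchable_trans [Finite W] {A : Set W} {x y z : W} (hx : x ∈ A)
    (hxy : Relation.ReflTransGen (IsAllowed Γ A) x y)
    (hyx : y ≠ x) (hzx : z ≠ x) (hyz : y ≠ z) (h1 : ¬ Matchable Γ (A \ {x, y}))
    (h2 : ¬ Matchable Γ (A \ {x, z})) : ¬ Matchable Γ (A \ {y, z}) := by
  have key : y ∈ A ∧ (y = x ∨ Matchable Γ (A \ {x, y}) ∨
      ∃ d ∈ A, Matchable Γ (A \ {x, d}) ∧ Γ.Adj d y) := by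
    clear h1 hyx hyz
    induction hxy with
    | refl => exact ⟨hx, Or.inl rfl⟩
    | @tail a c _ hac ih =>
      obtain ⟨haA, hcA, hadj, hm⟩ := hac
      refine ⟨hcA, ?_⟩
      by_contra! hcon
      obtain ⟨hcx, hxc, hD⟩ := hcon
      have hxa : ¬ Matchable Γ (A \ {x, a}) := fun h ↦ hD a haA h hadj
      have hax : a ≠ x := by rintro rfl; exact hxc hm
      obtain ⟨-, h | h | ⟨d, hdA, hxd, hda⟩⟩ := ih
      · exact hax h
      · exact hxa h
      · exact not_matchable_of_adj hx haA hdA hda hax hcx hadj.ne hxd hxa hxc hm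
  obtain ⟨hy, h | h | ⟨d, hdA, hxd, hdy⟩⟩ := key
  · exact absurd h hyx
  · exact absurd h h1
  · exact not_matchable_of_adj hx hy hdA hdy hyx hzx hyz hxd h1 h2

/-- Gallai's lemma in the form needed here: suppose that the subgraph induced by `A` has no perfect
matching, and that every `w ∈ A` is one of exactly two vertices of `A` missed by some matching. Then
no matching misses exactly two vertices that are connected by a path. The reason is that being
equal or not being such a pair is a transitive relation, which holds for adjacent vertices. -/
theorem gallai [Finite W] {A : Set W} (hA : ¬ Matchable Γ A)
    (hD : ∀ w ∈ A, ∃ s ∈ A, s ≠ w ∧ Matchable Γ (A \ {w, s})) {a b : W} (ha : a ∈ A)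
    (hab : Relation.ReflTransGen (fun x y ↦ Γ.Adj x y ∧ y ∈ A) a b) :
    a = b ∨ ¬ Matchable Γ (A \ {a, b}) := by
  suffices b ∈ A ∧ (a = b ∨ ¬ Matchable Γ (A \ {a, b})) from this.2
  induction hab with
  | refl => exact ⟨ha, Or.inl rfl⟩
  | @tail t b hr htb ih =>
    obtain ⟨hadj, hb⟩ := htb
    refine ⟨hb, ?_⟩
    have htb : ¬ Matchable Γ (A \ {t, b}) := fun h ↦
      hA ((h.addEdge hadj (by grind) (by grind)).congr (by grind))
    obtain ⟨ht, rfl | hat⟩ := ih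
    · exact Or.inr htb
    by_contra! hcon
    obtain ⟨hne, hm⟩ := hcon
    have h1 : t ≠ b := hadj.ne
    have h2 : t ≠ a := by
      rintro rfl
      exact htb hm
    obtain ⟨s, hs, hst, hts⟩ := hD t ht
    clear hr hD
    have hsa : s ≠ a := by rintro rfl; exact hat (hts.congr (by grind))
    have hsb : s ≠ b := by rintro rfl; exact htb hts
    -- covering `s` leaves uncovered one of the pairs `∅`, `{t, a}`, `{t, b}`
    obtain ⟨e', h3, h4, h5⟩ := hm.exchange hts (e := s) (by grind)
    have h6 : e' = t ∨ e' = a ∨ e' = b := by grind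
    rcases h6 with rfl | rfl | rfl
    · exact hA (h5.congr fun y ↦ by by_cases y = s <;> by_cases y = e' <;> grind)
    · exact hat (h5.congr (by grind))
    · exact htb (h5.congr (by grind))

end Gallai

/-! ### The largest critical set -/

section Critical

variable {W : Type*} {Γ : SimpleGraph W}

/-- The matching-theoretic content of `B ∪ W₀` being a critical-inducing set for `W₀`, relative to
a perfect matching `M`: the set `B` avoids `W₀`, is preserved by `M`, and for each `w ∈ B` there is
a perfect matching of `B ∪ {W₀} \ {w}`, where `z` is the vertex matched to the contracted `W₀`. -/
structure IsCrit (Γ : SimpleGraph W) (M : W → W) (W₀ B : Set W) : Prop where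
  notMem : ∀ x ∈ B, x ∉ W₀
  mapsTo : ∀ x ∈ B, M x ∈ B
  crit : ∀ w ∈ B, ∃ z ∈ B, z ≠ w ∧ (∃ x ∈ W₀, Γ.Adj x z) ∧ Matchable Γ (B \ {w, z})

/-- The union of all sets `B` with `IsCrit Γ M W₀ B`; it is itself the largest such set. -/
def maxCrit (Γ : SimpleGraph W) (M : W → W) (W₀ : Set W) : Set W :=
  {x | ∃ B, IsCrit Γ M W₀ B ∧ x ∈ B}

variable {M : W → W} {W₀ : Set W}

theorem IsMate.matchable {S : Set W} (hM : IsMate Γ M) (hMp : ∀ x, M x ≠ x)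
    (hS : ∀ x ∈ S, M x ∈ S) : Matchable Γ S :=
  hM.matchable_of_mapsTo hS fun x ↦ by simp [hMp x]

theorem IsMate.mapsTo_compl {S : Set W} (hM : IsMate Γ M)
    (hS : ∀ x ∈ S, M x ∈ S) : ∀ x ∈ Sᶜ, M x ∈ Sᶜ := by
  intro x hx h
  have := hS _ h
  rw [(hM x).1] at this
  exact hx this

theorem isCrit_maxCrit (hM : IsMate Γ M) (hMp : ∀ x, M x ≠ x) :
    IsCrit Γ M W₀ (maxCrit Γ M W₀) where
  notMem := fun x ⟨B, hB, hx⟩ ↦ hB.notMem x hx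
  mapsTo := fun x ⟨B, hB, hx⟩ ↦ ⟨B, hB, hB.mapsTo x hx⟩
  crit := by
    rintro w ⟨B, hB, hw⟩
    obtain ⟨z, hz, hzw, hadj, hm⟩ := hB.crit w hw
    refine ⟨z, ⟨B, hB, hz⟩, hzw, hadj, ?_⟩
    have hsub : ∀ x ∈ B, x ∈ maxCrit Γ M W₀ := fun x hx ↦ ⟨B, hB, hx⟩
    have h1 : Matchable Γ (maxCrit Γ M W₀ \ B) := by
      refine hM.matchable hMp fun x hx ↦ ⟨?_, hM.mapsTo_compl hB.mapsTo x hx.2⟩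
      obtain ⟨B', hB', hx'⟩ := hx.1
      exact ⟨B', hB', hB'.mapsTo x hx'⟩
    refine (hm.union h1 (by grind)).congr fun x ↦ ?_
    have := hsub x
    grind

/-- The vertices outside `W₀` and outside the largest critical set. -/
def critCompl (Γ : SimpleGraph W) (M : W → W) (W₀ : Set W) : Set W :=
  (W₀ ∪ maxCrit Γ M W₀)ᶜ

/-- If `R` is preserved by `M`, lies outside `W₀` and the largest critical set, and every
`R \ {w}` can be matched except for one vertex `q` having a neighbour in `W₀` or in the largest
critical set, then `R` could be added to the largest critical set. -/
theorem eq_empty_of_extends (hM : IsMate Γ M) (hMp : ∀ x, M x ≠ x) {R : Set W}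
    (hRY : ∀ x ∈ R, x ∈ critCompl Γ M W₀) (hRM : ∀ x ∈ R, M x ∈ R)
    (hR : ∀ w ∈ R, ∃ q ∈ R, q ≠ w ∧ (∃ t, t ∉ critCompl Γ M W₀ ∧ Γ.Adj t q) ∧
      Matchable Γ (R \ {w, q})) : R = ∅ := by
  have hB := isCrit_maxCrit (W₀ := W₀) hM hMp
  have hdis : ∀ x ∈ R, x ∉ maxCrit Γ M W₀ := fun x hx h ↦ hRY x hx (Or.inr h)
  set B := maxCrit Γ M W₀ with hBdef
  have hBm : Matchable Γ B := hM.matchable hMp hB.mapsTo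
  have hRm : Matchable Γ R := hM.matchable hMp hRM
  have hcrit : IsCrit Γ M W₀ (B ∪ R) := by
    refine ⟨?_, ?_, ?_⟩
    · rintro x (hx | hx) h
      · exact hB.notMem x hx h
      · exact hRY x hx (Or.inl h)
    · rintro x (hx | hx)
      · exact Or.inl (hB.mapsTo x hx)
      · exact Or.inr (hRM x hx)
    · rintro w (hw | hw)
      · obtain ⟨z, hz, hzw, hadj, hm⟩ := hB.crit w hw
        refine ⟨z, Or.inl hz, hzw, hadj, (hm.union hRm (by grind)).congr fun x ↦ ?_⟩
        have := hdis x
        grind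
      · obtain ⟨q, hq, hqw, ⟨t, ht, htq⟩, hm⟩ := hR w hw
        have ht : t ∈ W₀ ∨ t ∈ B := by
          simpa [critCompl, ← hBdef, or_iff_not_imp_left] using ht
        rcases ht with ht | ht
        · refine ⟨q, Or.inr hq, hqw, ⟨t, ht, htq⟩, (hBm.union hm (by grind)).congr fun x ↦ ?_⟩
          have := hdis x
          grind
        · obtain ⟨z, hz, hzt, hadj, hm'⟩ := hB.crit t ht
          refine ⟨z, Or.inl hz, by grind, hadj,
            ((hm'.union hm (by grind)).addEdge htq (by grind) (by grind)).congr fun x ↦ ?_⟩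
          have := hdis x
          have := hdis w hw
          have := hdis q hq
          clear hm hm' hadj hdis
          by_cases x = t <;> by_cases x = q <;> grind
  refine Set.eq_empty_of_forall_notMem fun x hx ↦ hdis x hx ⟨_, hcrit, Or.inr hx⟩

/-- There is no ear of the largest critical set: no two distinct vertices outside of it and of
`W₀`, both having a neighbour inside, can be deleted from the outside part so that a perfect
matching remains. The proof takes such a matching `g` that differs from `M` at as few vertices as
possible. Then the vertices where they differ, which form an alternating path from `y` to `z`,
could be added to the largest critical set. -/
theorem not_exists_ear [Finite W] (hM : IsMate Γ M) (hMp : ∀ x, M x ≠ x)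
    {f : W → W} (hf : IsMate Γ f) (hfY : ∀ x ∈ critCompl Γ M W₀, f x = M x)
    (hfY' : ∀ x ∉ critCompl Γ M W₀, f x = x) {y z : W} (hyz : y ≠ z)
    (hy : y ∈ critCompl Γ M W₀) (hz : z ∈ critCompl Γ M W₀)
    (hyt : ∃ t, t ∉ critCompl Γ M W₀ ∧ Γ.Adj t y) (hzt : ∃ t, t ∉ critCompl Γ M W₀ ∧ Γ.Adj t z) :
    ¬ Matchable Γ (critCompl Γ M W₀ \ {y, z}) := by
  classical
  rintro ⟨g, hg, hgY⟩
  induction hn : {x | g x ≠ f x}.ncard using Nat.strong_induction_on generalizing g with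
  | _ n ih =>
  set Y := critCompl Γ M W₀ with hY
  have hfx : ∀ x ∈ Y, f x ≠ x := fun x hx ↦ by rw [hfY x hx]; exact hMp x
  have hgy : g y = y := by have := hgY y; grind
  have hgz : g z = z := by have := hgY z; grind
  obtain ⟨R, hR⟩ : ∃ R : Set W, ∀ x, x ∈ R ↔ g x ≠ f x := ⟨{x | g x ≠ f x}, fun x ↦ Iff.rfl⟩
  have hRY : ∀ x ∈ R, x ∈ Y := by
    intro x hx
    by_contra h
    have := hgY x
    have := hfY' x h
    have := hR x
    grind
  have hRf : ∀ x ∈ R, f x ∈ R := by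
    intro x hx
    have h1 := (hf x).1
    have h2 := (hg (f x)).1
    have := hR x
    have := hR (f x)
    grind
  have hRg : ∀ x ∈ R, g x ∈ R := by
    intro x hx
    have h1 := (hg x).1
    have h2 := (hf (g x)).1
    have := hR x
    have := hR (g x)
    grind
  have hyR : y ∈ R := (hR y).2 (by rw [hgy]; exact (hfx y hy).symm)
  have hzR : z ∈ R := (hR z).2 (by rw [hgz]; exact (hfx z hz).symm)
  have hyzR : Matchable Γ (R \ {y, z}) := by
    refine hg.matchable_of_mapsTo hRg fun x ↦ ?_
    have := hgY x
    have := hRY x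
    grind
  have hRe : R = ∅ := by
    refine eq_empty_of_extends hM hMp hRY (fun x hx ↦ ?_) fun w hw ↦ ?_
    · rw [← hfY x (hRY x hx)]
      exact hRf x hx
    by_cases hwy : w = y
    · exact ⟨z, hzR, by grind, hzt, hwy ▸ hyzR⟩
    by_cases hwz : w = z
    · exact ⟨y, hyR, by grind, hyt, hwz ▸ hyzR.congr (by grind)⟩
    have hgw : g w ≠ w := (hgY w).2 ⟨hRY w hw, by grind⟩
    have hggw := (hg w).1
    have hgwR := hRg w hw
    have hgwy : g w ≠ y := by grind
    have hgwz : g w ≠ z := by grind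
    -- delete the edge `{w, g w}` from `g`, and cover `g w` again by an exchange towards `M`
    obtain ⟨g', hg', hg'def⟩ : ∃ g', IsMate Γ g' ∧
        ∀ x, g' x = if x = w then w else if x = g w then g w else g x :=
      ⟨_, hg.removeEdge w, fun _ ↦ rfl⟩
    have hfgw := hfx _ (hRY _ hgwR)
    obtain ⟨e', h, h1, h2, h3, h4, h5, h6, h7⟩ := hf.exchange hg' (e := g w) (by grind)
    have he' : e' = w ∨ e' = y ∨ e' = z := by
      by_contra! hcon
      have := hgY e'
      have := hfY' e'
      have := hfx e'
      have := hg'def e'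
      grind
    have hfw := hfx _ (hRY _ hw)
    have hcases : ∀ x, h x ≠ x ↔ x ∈ Y \ {y, z} ∧ x ≠ w ∨ x = e' := by
      intro x
      have := hgY x
      have := h7 x
      have := hg'def x
      have := hfx e'
      have := hRY w hw
      have := hRY _ hgwR
      clear ih hn
      by_cases x = e' <;> by_cases x = g w <;> by_cases x = w <;> grind
    have hoff : ∀ x ∉ R, h x = f x := by
      intro x hx
      have := h4 x
      have := hg'def x
      have := hR x
      clear ih hn
      grind
    by_cases hew : e' = w
    · refine (ih _ ?_ h h2 (fun x ↦ ?_) rfl).elim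
      · rw [← hn]
        refine Set.ncard_lt_ncard ⟨fun x hx ↦ ?_, fun hsub ↦ ?_⟩ (Set.toFinite _)
        · refine (hR x).1 ?_
          by_contra hxR
          exact hx (hoff x hxR)
        · refine hsub ((hR w).1 hw) ?_
          have := h4 w
          have := hg'def w
          clear ih hn
          grind
      · have := hcases x
        clear ih hn
        by_cases x = w <;> grind
    · have hRh : ∀ x ∈ R, h x ∈ R := by
        intro x hx
        by_contra hcon
        have h8 := hoff _ hcon
        rw [(h2 x).1] at h8
        have h9 := hRf x hx
        rw [h8, (hf _).1] at h9
        exact hcon h9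
      clear ih hn
      rcases he' with he' | he' | he'
      · exact absurd he' hew
      · refine ⟨z, hzR, by grind, hzt, h2.matchable_of_mapsTo hRh fun x ↦ ?_⟩
        have := hcases x
        have := hRY x
        by_cases x = w <;> by_cases x = e' <;> grind
      · refine ⟨y, hyR, by grind, hyt, h2.matchable_of_mapsTo hRh fun x ↦ ?_⟩
        have := hcases x
        have := hRY x
        by_cases x = w <;> by_cases x = e' <;> grind
  rw [hRe] at hyR
  exact hyR

end Critical

/-! ### Graphs with a perfect matching -/

section Perfect

variable {W : Type*} {Γ : SimpleGraph W} {M : W → W} {W₀ : Set W}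

/-- A matching that covers everything outside `W₀` and the largest critical set matches the
vertices outside among themselves, for otherwise the exchange property yields an ear. -/
theorem IsMate.mapsTo_critCompl [Finite W] (hM : IsMate Γ M) (hMp : ∀ x, M x ≠ x)
    (hY : ∀ x ∈ critCompl Γ M W₀, M x ∈ critCompl Γ M W₀) {N : W → W} (hN : IsMate Γ N)
    (hNY : ∀ x ∈ critCompl Γ M W₀, N x ≠ x) :
    ∀ x ∈ critCompl Γ M W₀, N x ∈ critCompl Γ M W₀ := by
  classical
  intro a ha
  by_contra hNa
  set Y := critCompl Γ M W₀ with hYdef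
  obtain ⟨f, hf, hfdef⟩ : ∃ f, IsMate Γ f ∧ ∀ x, f x = if x ∈ Y ∧ M x ∈ Y then M x else x :=
    ⟨_, hM.restrict Y, fun _ ↦ rfl⟩
  have hNm : Matchable Γ {x | x ∈ Y ∧ N x ∈ Y} := by
    refine hN.matchable_of_mapsTo (S := {x | x ∈ Y ∧ N x ∈ Y}) (fun x hx ↦ ⟨hx.2, ?_⟩)
      fun x ↦ ⟨fun hx ↦ ⟨hx, hNY x hx.1⟩, fun hx ↦ hx.1⟩
    rw [(hN x).1]
    exact hx.1
  obtain ⟨e, he1, he2, he3⟩ := hNm.exchange (hM.matchable hMp hY) (e := a)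
    (by simp only [Set.mem_ofPred_eq]; tauto)
  simp only [Set.mem_ofPred_eq] at he2 he3
  have heY : e ∈ Y := by tauto
  have hNe : N e ∉ Y := by tauto
  have hadj : ∀ x ∈ Y, N x ∉ Y → ∃ t, t ∉ Y ∧ Γ.Adj t x := fun x hx hNx ↦
    ⟨N x, hNx, ((hN x).2.resolve_left (hNY x hx)).symm⟩
  refine not_exists_ear hM hMp hf (fun x hx ↦ ?_) (fun x hx ↦ ?_) he1.symm ha heY (hadj a ha hNa)
    (hadj e heY hNe) (he3.congr fun x ↦ ?_)
  · have := hY x hx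
    grind
  · grind
  · by_cases x = a <;> by_cases x = e <;> grind

/-- Let `K` be connected and perfectly matchable, and suppose that it can be matched up to any given
vertex `w` and some other vertex of `P₁ ∪ P₂`. Then it can be matched up to a vertex of `P₁` and a
vertex of `P₂`: otherwise, joining one new vertex to `P₁` and another one to `P₂` would give a
graph contradicting Gallai's lemma. The vertices `u` and `s` serve as the new vertices. -/
theorem exists_matchable_diff [Finite W] {K P₁ P₂ : Set W} (hK : Matchable Γ K)
    (hconn : ∀ x ∈ K, ∀ y ∈ K, Relation.ReflTransGen (fun x y ↦ Γ.Adj x y ∧ y ∈ K) x y)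
    (hP₁ : P₁ ⊆ K) (hP₂ : P₂ ⊆ K) (hne₁ : P₁.Nonempty) (hne₂ : P₂.Nonempty)
    (hcov : ∀ w ∈ K, ∃ z ∈ K, z ≠ w ∧ (z ∈ P₁ ∨ z ∈ P₂) ∧ Matchable Γ (K \ {w, z}))
    {u s : W} (hu : u ∉ K) (hs : s ∉ K) (hus : u ≠ s) :
    ∃ p ∈ P₁, ∃ q ∈ P₂, p ≠ q ∧ Matchable Γ (K \ {p, q}) := by
  by_contra! hcon
  obtain ⟨Γ', hΓ'⟩ : ∃ Γ' : SimpleGraph W, ∀ a b, Γ'.Adj a b ↔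
      (a ∈ K ∧ b ∈ K ∧ Γ.Adj a b) ∨ (a = u ∧ b ∈ P₁) ∨ (b = u ∧ a ∈ P₁) ∨
        (a = s ∧ b ∈ P₂) ∨ (b = s ∧ a ∈ P₂) := by
    refine ⟨⟨fun a b ↦ (a ∈ K ∧ b ∈ K ∧ Γ.Adj a b) ∨ (a = u ∧ b ∈ P₁) ∨ (b = u ∧ a ∈ P₁) ∨
        (a = s ∧ b ∈ P₂) ∨ (b = s ∧ a ∈ P₂), ⟨fun a b h ↦ ?_⟩, ⟨fun a h ↦ ?_⟩⟩, fun a b ↦ Iff.rfl⟩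
    · have := Γ.adj_comm a b
      tauto
    · rcases h with h | h | h | h | h
      · exact Γ.loopless.irrefl _ h.2.2
      · exact hu (h.1 ▸ hP₁ h.2)
      · exact hu (h.1 ▸ hP₁ h.2)
      · exact hs (h.1 ▸ hP₂ h.2)
      · exact hs (h.1 ▸ hP₂ h.2)
  have hup : ∀ S ⊆ K, Matchable Γ S → Matchable Γ' S := by
    rintro S hS ⟨f, hf, hfS⟩
    refine ⟨f, fun x ↦ ⟨(hf x).1, ?_⟩, hfS⟩
    have h1 := hf x
    have h2 := hfS x
    have h3 := hfS (f x)
    rw [hΓ']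
    by_cases hx : f x = x
    · exact Or.inl hx
    · exact Or.inr (Or.inl ⟨hS (h2.1 hx), hS (h3.1 (by rw [h1.1]; exact Ne.symm hx)),
        h1.2.resolve_left hx⟩)
  have hau : ∀ p ∈ P₁, Γ'.Adj u p := fun p hp ↦ (hΓ' u p).2 (by tauto)
  have has : ∀ p ∈ P₂, Γ'.Adj s p := fun p hp ↦ (hΓ' s p).2 (by tauto)
  have hA : ¬ Matchable Γ' (K ∪ {u, s}) := by
    rintro ⟨f, hf, hfA⟩
    have huP : f u ∈ P₁ := by
      have := (hf u).2.resolve_left ((hfA u).2 (by simp))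
      rw [hΓ'] at this
      have := @hP₁ u
      have := @hP₂ u
      tauto
    have hsP : f s ∈ P₂ := by
      have := (hf s).2.resolve_left ((hfA s).2 (by simp))
      rw [hΓ'] at this
      have := @hP₁ s
      have := @hP₂ s
      grind
    have hfu := (hf u).1
    have hfs := (hf s).1
    have hne : f u ≠ f s := by grind
    have hcl : ∀ x ∈ K \ {f u, f s}, f x ∈ K \ {f u, f s} ∧ Γ.Adj x (f x) := by
      intro x hx
      have h1 := (hf x).2.resolve_left ((hfA x).2 (by grind))
      rw [hΓ'] at h1
      have h2 := (hf x).1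
      clear hcon hcov hconn
      grind
    refine hcon _ huP _ hsP hne ?_
    classical
    refine ⟨fun x ↦ if x ∈ K \ {f u, f s} then f x else x, fun x ↦ ?_, fun x ↦ ?_⟩
    · by_cases hx : x ∈ K \ {f u, f s}
      · have := hcl x hx
        simp only [hx, this.1, if_true]
        exact ⟨(hf x).1, Or.inr this.2⟩
      · simp only [hx, if_false, true_or, and_self]
    · by_cases hx : x ∈ K \ {f u, f s}
      · have := (hcl x hx).2.ne'
        simp only [hx, if_true, iff_true]
        exact this
      · simp only [hx, if_false, ne_eq, not_true_eq_false]
  obtain ⟨p, hp⟩ := hne₁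
  obtain ⟨q, hq⟩ := hne₂
  have hKus : Matchable Γ' ((K ∪ {u, s}) \ {u, s}) := by
    have := hup K subset_rfl hK
    clear hconn hcov hcon hA
    exact this.congr fun x ↦ by grind
  have hpath : Relation.ReflTransGen (fun x y ↦ Γ'.Adj x y ∧ y ∈ K ∪ {u, s}) u s := by
    refine (Relation.ReflTransGen.head ⟨hau p hp, Or.inl (hP₁ hp)⟩ ?_).tail
      ⟨(has q hq).symm, by simp⟩
    suffices ∀ y, Relation.ReflTransGen (fun x y ↦ Γ.Adj x y ∧ y ∈ K) p y → y ∈ K ∧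
        Relation.ReflTransGen (fun x y ↦ Γ'.Adj x y ∧ y ∈ K ∪ {u, s}) p y from
      (this q (hconn p (hP₁ hp) q (hP₂ hq))).2
    intro y hy
    induction hy with
    | refl => exact ⟨hP₁ hp, .refl⟩
    | tail _ h ih => exact ⟨h.2, ih.2.tail ⟨(hΓ' _ _).2 (Or.inl ⟨ih.1, h.2, h.1⟩), Or.inl h.2⟩⟩
  refine (gallai hA (fun w hw ↦ ?_) (by simp) hpath).elim hus fun h ↦ h hKus
  rcases hw with hw | rfl | rfl
  · obtain ⟨z, hz, hzw, hzP, hm⟩ := hcov w hw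
    have hm' := hup _ Set.sdiff_subset hm
    clear hconn hcov hpath hcon
    rcases hzP with hzP | hzP
    · refine ⟨s, by simp, by grind,
        (hm'.addEdge (hau z hzP) (by grind) (by grind)).congr fun x ↦ ?_⟩
      by_cases x = z <;> by_cases x = u <;> by_cases x = s <;> grind
    · refine ⟨u, by simp, by grind,
        (hm'.addEdge (has z hzP) (by grind) (by grind)).congr fun x ↦ ?_⟩
      by_cases x = z <;> by_cases x = u <;> by_cases x = s <;> grind
  · exact ⟨s, by simp, hus.symm, hKus⟩
  · exact ⟨u, by simp, hus, by rwa [Set.pair_comm w u]⟩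

theorem IsAllowed.exists_isMate {a b : W} (h : IsAllowed Γ Set.univ a b) :
    ∃ N, IsMate Γ N ∧ (∀ x, N x ≠ x) ∧ N a = b := by
  classical
  obtain ⟨-, -, hab, f, hf, hfS⟩ := h
  have h1 := hfS a
  have h2 := hfS b
  have := hab.ne
  refine ⟨_, hf.addEdge hab (by grind) (by grind), fun x ↦ ?_, by simp⟩
  have := hfS x
  grind

theorem IsMate.isAllowed {N : W → W} (hN : IsMate Γ N) (hNp : ∀ x, N x ≠ x) (a : W) :
    IsAllowed Γ Set.univ a (N a) :=
  ⟨trivial, trivial, (hN a).2.resolve_left (hNp a),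
    hN.matchable_diff_edge (fun x ↦ by simp [hNp x]) a⟩

/-- A matching of `B` that misses `w` and `z` only restricts to every union `K` of connected
components of the subgraph induced by `B`; by parity, `w` and `z` lie in the same one. -/
theorem Matchable.of_component [Finite W] {B K : Set W} {w z : W} (hm : Matchable Γ (B \ {w, z}))
    (hKB : ∀ x ∈ K, x ∈ B) (hKstep : ∀ x ∈ K, ∀ y ∈ B, Γ.Adj x y → y ∈ K) (hK : Matchable Γ K)
    (hw : w ∈ K) : z ∈ K ∧ Matchable Γ (K \ {w, z}) := by
  obtain ⟨f, hf, hfS⟩ := hm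
  have hfK : ∀ x ∈ K, f x ∈ K := by
    intro x hx
    by_cases hfx : f x = x
    · rwa [hfx]
    refine hKstep x hx _ ?_ ((hf x).2.resolve_left hfx)
    exact ((hfS (f x)).1 (by rw [(hf x).1]; exact Ne.symm hfx)).1
  have hfK' : Matchable Γ {x | x ∈ K ∧ f x ≠ x} := hf.matchable_of_mapsTo hfK fun x ↦ Iff.rfl
  have hzK : z ∈ K := by
    by_contra hzK
    obtain ⟨e, he1, he2, -⟩ := hfK'.exchange hK (e := w) (by have := hfS w; grind)
    have := hfS e
    have := hKB e
    grind
  refine ⟨hzK, hfK'.congr fun x ↦ ?_⟩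
  have := hfS x
  have := hKB x
  grind

/-- A matching `N` that misses `u` and `v` only is turned into one of the complement of `K`, missing
`u` and a vertex `s`, where `s` is `v` or a vertex that `N` matches into `K`. -/
theorem exists_matchable_compl [Finite W] {K : Set W} {u v : W} {N : W → W} (hN : IsMate Γ N)
    (hNS : ∀ x, N x ≠ x ↔ x ∈ Set.univ \ {u, v}) (hK : Matchable Γ Kᶜ) (hu : u ∉ K) :
    ∃ s, (s = v ∨ N s ∈ K ∧ N s ≠ s) ∧ s ∉ K ∧ s ≠ u ∧ Matchable Γ (Kᶜ \ {u, s}) := by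
  have h1 : Matchable Γ {x | x ∉ K ∧ N x ∉ K ∧ N x ≠ x} := by
    refine hN.matchable_of_mapsTo (S := {x | x ∉ K ∧ N x ∉ K})
      (fun x hx ↦ ⟨hx.2, by rw [(hN x).1]; exact hx.1⟩) fun x ↦ ?_
    simp only [Set.mem_ofPred_eq]
    tauto
  have hNu : N u = u := by have := hNS u; grind
  obtain ⟨e, he1, he2, he3⟩ := h1.exchange hK (e := u) (by grind)
  have heK : e ∉ K := by grind
  have := hNS e
  refine ⟨e, by grind, heK, he1, he3.congr fun x ↦ ?_⟩
  by_cases x = e <;> by_cases x = u <;> grind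

theorem IsMate.matchable_compl_diff {N : W → W} (hN : IsMate Γ N) (hNp : ∀ x, N x ≠ x)
    {K : Set W} (hK : ∀ x ∈ K, N x ∈ K) {a b : W} (hab : N a = b) : Matchable Γ (Kᶜ \ {a, b}) := by
  have hba := (hN a).1
  refine hN.matchable hNp fun x hx ↦ ⟨hN.mapsTo_compl hK x hx.1, fun h ↦ hx.2 ?_⟩
  have := (hN x).1
  grind

/-- Matchings of `K` and of its complement, each missing two vertices, combine with two edges
between the missed vertices to a perfect matching, here with the edge `{x, p}` left out. -/
theorem matchable_of_ear {K : Set W} {x y p q : W} (hp : p ∈ K) (hq : q ∈ K) (hx : x ∉ K)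
    (hy : y ∉ K) (hxy : x ≠ y) (hpq : p ≠ q) (hyq : Γ.Adj y q) (hm : Matchable Γ (K \ {p, q}))
    (hm' : Matchable Γ (Kᶜ \ {x, y})) : Matchable Γ (Set.univ \ {x, p}) := by
  refine ((hm.union hm' (by grind)).addEdge hyq (by grind) (by grind)).congr fun w ↦ ?_
  by_cases w = x <;> by_cases w = y <;> by_cases w = p <;> by_cases w = q <;> grind

/-- The theorem for a graph with a perfect matching. Here `W₀` is a component of the graph of
allowed edges, and `u` and `v` are adjacent to the same connected component of the largest critical
set. -/
theorem not_matchable_of_reachable [Finite W] (hM : IsMate Γ M) (hMp : ∀ x, M x ≠ x)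
    (hW₀ : ∀ x ∈ W₀, ∀ y, IsAllowed Γ Set.univ x y → y ∈ W₀)
    (hconn : ∀ x ∈ W₀, ∀ y ∈ W₀, Relation.ReflTransGen (IsAllowed Γ Set.univ) x y)
    {u v p q : W} (hu : u ∈ W₀) (hv : v ∈ W₀) (huv : u ≠ v) (hp : p ∈ maxCrit Γ M W₀)
    (hpq : Relation.ReflTransGen
      (fun x y ↦ Γ.Adj x y ∧ x ∈ maxCrit Γ M W₀ ∧ y ∈ maxCrit Γ M W₀) p q)
    (hup : Γ.Adj u p) (hvq : Γ.Adj v q) : ¬ Matchable Γ (Set.univ \ {u, v}) := by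
  rintro ⟨N, hN, hNS⟩
  have hcrit := isCrit_maxCrit (W₀ := W₀) hM hMp
  have hYdef : ∀ x, x ∈ critCompl Γ M W₀ ↔ x ∉ W₀ ∧ x ∉ maxCrit Γ M W₀ := by
    simp [critCompl]
  have hpres₀ : ∀ N, IsMate Γ N → (∀ x, N x ≠ x) → ∀ x ∈ W₀, N x ∈ W₀ :=
    fun N hN hNp x hx ↦ hW₀ x hx _ (hN.isAllowed hNp x)
  have hMY : ∀ x ∈ critCompl Γ M W₀, M x ∈ critCompl Γ M W₀ := by
    refine hM.mapsTo_compl ?_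
    rintro x (hx | hx)
    · exact Or.inl (hpres₀ M hM hMp x hx)
    · exact Or.inr (hcrit.mapsTo x hx)
  have hpresY := fun (N : W → W) (hN : IsMate Γ N) ↦ hM.mapsTo_critCompl hMp hMY hN
  set B := maxCrit Γ M W₀ with hB
  set Y := critCompl Γ M W₀ with hY
  -- the connected component of `p` and `q` in the subgraph induced by `B`
  obtain ⟨K, hKdef⟩ : ∃ K : Set W, ∀ x, x ∈ K ↔
      Relation.ReflTransGen (fun x y ↦ Γ.Adj x y ∧ x ∈ B ∧ y ∈ B) p x := ⟨{x | _}, fun _ ↦ Iff.rfl⟩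
  have hpK : p ∈ K := (hKdef p).2 .refl
  have hqK : q ∈ K := (hKdef q).2 hpq
  have hKB : ∀ x ∈ K, x ∈ B := by
    intro x hx
    rcases ((hKdef x).1 hx).cases_tail with h | ⟨_, -, h⟩
    · exact h ▸ hp
    · exact h.2.2
  have hKstep : ∀ x ∈ K, ∀ y ∈ B, Γ.Adj x y → y ∈ K := fun x hx y hy hxy ↦
    (hKdef y).2 (((hKdef x).1 hx).tail ⟨hxy, hKB x hx, hy⟩)
  have hKW₀ : ∀ x ∈ K, x ∉ W₀ := fun x hx ↦ hcrit.notMem x (hKB x hx)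
  have hKconn : ∀ x ∈ K, ∀ y ∈ K, Relation.ReflTransGen (fun x y ↦ Γ.Adj x y ∧ y ∈ K) x y := by
    have hsymm : ∀ {x y}, Relation.ReflTransGen (fun x y ↦ Γ.Adj x y ∧ x ∈ B ∧ y ∈ B) x y →
        Relation.ReflTransGen (fun x y ↦ Γ.Adj x y ∧ x ∈ B ∧ y ∈ B) y x := by
      intro x y h
      induction h with
      | refl => exact .refl
      | tail _ h ih => exact .head ⟨h.1.symm, h.2.2, h.2.1⟩ ih
    intro x hx y hy
    have h1 := (hsymm ((hKdef x).1 hx)).trans ((hKdef y).1 hy)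
    clear hy
    suffices y ∈ K ∧ Relation.ReflTransGen (fun x y ↦ Γ.Adj x y ∧ y ∈ K) x y from this.2
    induction h1 with
    | refl => exact ⟨hx, .refl⟩
    | tail _ h ih =>
      have := hKstep _ ih.1 _ h.2.2 h.1
      exact ⟨this, ih.2.tail ⟨h.1, this⟩⟩
  -- perfect matchings preserve `W₀` and `Y`, hence `B` and its connected components
  have hpresK : ∀ N, IsMate Γ N → (∀ x, N x ≠ x) → ∀ x ∈ K, N x ∈ K := by
    intro N hN hNp x hx
    have hNN := (hN x).1
    refine hKstep x hx _ ?_ ((hN x).2.resolve_left (hNp x))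
    have h1 := hpres₀ N hN hNp (N x)
    have h2 := hpresY N hN (fun x _ ↦ hNp x) (N x)
    rw [hNN, hYdef, hYdef] at h2
    rw [hNN] at h1
    have := hKB x hx
    have := hKW₀ x hx
    tauto
  have hKm : Matchable Γ K := hM.matchable hMp (hpresK M hM hMp)
  have hKcm : Matchable Γ Kᶜ := hM.matchable hMp (hM.mapsTo_compl (hpresK M hM hMp))
  have hcov : ∀ w ∈ K, ∃ z ∈ K, z ≠ w ∧ (∃ x ∈ W₀, Γ.Adj x z) ∧ Matchable Γ (K \ {w, z}) := by
    intro w hw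
    obtain ⟨z, hz, hzw, hadj, hm⟩ := hcrit.crit w (hKB w hw)
    obtain ⟨hzK, hm'⟩ := hm.of_component hKB hKstep hKm hw
    exact ⟨z, hzK, hzw, hadj, hm'⟩
  have huK : u ∉ K := fun h ↦ hKW₀ u h hu
  obtain ⟨s, hs, hsK, hsu, hsm⟩ := exists_matchable_compl hN hNS hKcm huK
  obtain ⟨hsW₀, k, hk, hsk⟩ : s ∈ W₀ ∧ ∃ k ∈ K, Γ.Adj s k := by
    rcases hs with rfl | ⟨hs, hNs⟩
    · exact ⟨hv, q, hqK, hvq⟩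
    · have hadj : Γ.Adj s (N s) := (hN s).2.resolve_left hNs
      refine ⟨?_, N s, hs, hadj⟩
      by_contra hsW
      have hsB : s ∉ B := fun h ↦ hsK (hKstep _ hs s h hadj.symm)
      have hNY := hpresY N hN (fun x hx ↦ (hNS x).2 ⟨trivial, ?_⟩) s ((hYdef s).2 ⟨hsW, hsB⟩)
      · exact ((hYdef _).1 hNY).2 (hKB _ hs)
      · rintro (rfl | rfl)
        · exact ((hYdef _).1 hx).1 hu
        · exact ((hYdef _).1 hx).1 hv
  have hallowed : ∀ x ∈ W₀, ∀ y, Relation.ReflTransGen (IsAllowed Γ Set.univ) x y →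
      y ∈ W₀ ∧ Relation.ReflTransGen (IsAllowed Γ Kᶜ) x y := by
    intro x hx y hxy
    induction hxy with
    | refl => exact ⟨hx, .refl⟩
    | @tail a b _ hab ih =>
      have hb := hW₀ a ih.1 b hab
      obtain ⟨N', hN', hNp', hNab⟩ := hab.exists_isMate
      exact ⟨hb, ih.2.tail ⟨fun h ↦ hKW₀ a h ih.1, fun h ↦ hKW₀ b h hb, hab.2.2.1,
        hN'.matchable_compl_diff hNp' (hpresK N' hN' hNp') hNab⟩⟩
  -- Split the neighbours of `K` in `W₀` into the class of `u` and the rest, which contains `s`.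
  obtain ⟨p', hp', q', hq', hpq', hm⟩ := exists_matchable_diff hKm hKconn
    (P₁ := {k | k ∈ K ∧ ∃ x ∈ W₀, (x = u ∨ ¬ Matchable Γ (Kᶜ \ {x, u})) ∧ Γ.Adj x k})
    (P₂ := {k | k ∈ K ∧ ∃ x ∈ W₀, x ≠ u ∧ Matchable Γ (Kᶜ \ {u, x}) ∧ Γ.Adj x k})
    (fun _ h ↦ h.1) (fun _ h ↦ h.1) ⟨p, hpK, u, hu, Or.inl rfl, hup⟩
    ⟨k, hk, s, hsW₀, hsu, hsm, hsk⟩ (fun w hw ↦ by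
      obtain ⟨z, hz, hzw, ⟨x, hx, hxz⟩, hm⟩ := hcov w hw
      refine ⟨z, hz, hzw, ?_, hm⟩
      by_cases h : x = u ∨ ¬ Matchable Γ (Kᶜ \ {x, u})
      · exact Or.inl ⟨hz, x, hx, h, hxz⟩
      · push Not at h
        exact Or.inr ⟨hz, x, hx, h.1, by rw [Set.pair_comm]; exact h.2, hxz⟩) huK hsK hsu.symm
  obtain ⟨hp'K, x, hx, hxu, hxp⟩ := hp'
  obtain ⟨hq'K, y, hy, hyu, hym, hyq⟩ := hq'
  have hxy : x ≠ y := by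
    rintro rfl
    exact hxu.elim hyu fun h ↦ h (by rwa [Set.pair_comm])
  have hxK : x ∉ K := fun h ↦ hKW₀ x h hx
  have hyK : y ∉ K := fun h ↦ hKW₀ y h hy
  have hxym : ¬ Matchable Γ (Kᶜ \ {x, y}) := by
    intro h
    refine hKW₀ p' hp'K (hW₀ x hx p' ⟨trivial, trivial, hxp, ?_⟩)
    exact matchable_of_ear hp'K hq'K hxK hyK hxy hpq' hyq hm h
  rcases hxu with rfl | hxu
  · exact hxym hym
  · by_cases hxu' : u = x
    · exact hxym (hxu' ▸ hym)
    exact not_matchable_trans hxK (hallowed x hx u (hconn x hx u hu)).2 hxu' hxy.symm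
      hyu.symm hxu hxym hym

end Perfect

/-! ### Matching number, deficiency and the extension -/

section Deficiency

variable {V : Type*} {G : SimpleGraph V}

theorem ncard_verts_of_isMatching [Finite V] {M : G.Subgraph} (hM : M.IsMatching) :
    M.verts.ncard = 2 * M.edgeSet.ncard := by
  classical
  have := Fintype.ofFinite V
  have h1 := M.spanningCoe.sum_degrees_eq_twice_card_edges
  have h2 : ∀ v, M.spanningCoe.degree v = if v ∈ M.verts then 1 else 0 := by
    intro v
    rw [SimpleGraph.Subgraph.degree_spanningCoe]
    split_ifs with hv
    · exact (SimpleGraph.Subgraph.isMatching_iff_forall_degree.1 hM) v hv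
    · exact SimpleGraph.Subgraph.degree_of_notMem_verts hv
  simp only [h2, Finset.sum_boole, Nat.cast_id] at h1
  rw [Set.ncard_eq_toFinset_card', Set.ncard_eq_toFinset_card',
    ← SimpleGraph.Subgraph.edgeSet_spanningCoe]
  convert h1 using 2
  · ext; simp
  · simp only [SimpleGraph.edgeFinset]
    congr!

theorem exists_isMate_of_isMatching {M : G.Subgraph} (hM : M.IsMatching) :
    ∃ f, IsMate G f ∧ (∀ a b, M.Adj a b → f a = b) ∧ ∀ a, f a ≠ a ↔ a ∈ M.verts := by
  obtain ⟨f, hf, h1, h2⟩ := exists_isMate_of_rel (Γ := G) M.Adj (fun _ _ h ↦ h.symm)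
    (fun _ _ h ↦ M.adj_sub h) (fun a b c h h' ↦ hM.eq_of_adj_left h h')
  refine ⟨f, hf, h1, fun a ↦ (h2 a).trans ⟨fun ⟨b, hb⟩ ↦ M.edge_vert hb, fun ha ↦ ?_⟩⟩
  obtain ⟨b, hb, -⟩ := hM ha
  exact ⟨b, hb⟩

/-- The matching subgraph with the edges `{x, f x}`. -/
def IsMate.subgraph {f : V → V} (hf : IsMate G f) : G.Subgraph where
  verts := {x | f x ≠ x}
  Adj a b := f a = b ∧ a ≠ b
  adj_sub := by
    rintro a _ ⟨rfl, h⟩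
    exact (hf a).2.resolve_left h.symm
  edge_vert := by
    rintro a _ ⟨rfl, h⟩
    exact h.symm
  symm := ⟨by
    rintro a _ ⟨rfl, h⟩
    exact ⟨(hf a).1, h.symm⟩⟩

theorem IsMate.isMatching_subgraph {f : V → V} (hf : IsMate G f) : hf.subgraph.IsMatching :=
  fun a ha ↦ ⟨f a, ⟨rfl, Ne.symm ha⟩, fun _ h ↦ h.1.symm⟩

/-- The graph `G` with `d` new pairwise non-adjacent vertices, each joined to every vertex of `G`.
If `d` is the deficiency of `G`, then its perfect matchings are the maximum matchings of `G`,
completed by a bijection between the missed vertices and the new ones. -/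
def extension (G : SimpleGraph V) (d : ℕ) : SimpleGraph (V ⊕ Fin d) where
  Adj
    | .inl a, .inl b => G.Adj a b
    | .inl _, .inr _ => True
    | .inr _, .inl _ => True
    | .inr _, .inr _ => False
  symm := ⟨by
    rintro (a | i) (b | j) h
    · exact SimpleGraph.Adj.symm h
    · trivial
    · trivial
    · exact h⟩
  loopless := ⟨by
    rintro (a | i) h
    · exact G.loopless.irrefl _ h
    · exact h⟩

theorem Matchable.image_inl {d : ℕ} {S : Set V} (h : Matchable G S) :
    Matchable (extension G d) (Sum.inl '' S) := by
  obtain ⟨f, hf, hfS⟩ := h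
  refine ⟨Sum.map f id, ?_, ?_⟩
  · rintro (a | i)
    · simp only [Sum.map_inl, Sum.inl.injEq]
      exact hf a
    · simp
  · rintro (a | i)
    · simp [← hfS]
    · simp

variable [Finite V]

theorem bddAbove_matching (G : SimpleGraph V) :
    BddAbove {n : ℕ | ∃ M : G.Subgraph, M.IsMatching ∧ M.edgeSet.ncard = n} := by
  refine ⟨Nat.card V, ?_⟩
  rintro _ ⟨M, hM, rfl⟩
  have h1 := ncard_verts_of_isMatching hM
  have h2 := Set.ncard_le_card M.verts
  omega

theorem exists_isMatching_matchingNumber (G : SimpleGraph V) :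
    ∃ M : G.Subgraph, M.IsMatching ∧ M.edgeSet.ncard = matchingNumber G :=
  Nat.sSup_mem (s := {n : ℕ | ∃ M : G.Subgraph, M.IsMatching ∧ M.edgeSet.ncard = n})
    ⟨_, ⊥, fun _ hv ↦ hv.elim, rfl⟩ (bddAbove_matching G)

theorem IsMate.ncard_le {f : V → V} (hf : IsMate G f) :
    {x | f x ≠ x}.ncard ≤ 2 * matchingNumber G := by
  have h1 := ncard_verts_of_isMatching hf.isMatching_subgraph
  have h2 : hf.subgraph.edgeSet.ncard ≤ matchingNumber G :=
    le_csSup (bddAbove_matching G) ⟨_, hf.isMatching_subgraph, rfl⟩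
  have h3 : {x | f x ≠ x} = hf.subgraph.verts := rfl
  rw [h3]
  omega

theorem exists_isMate_ncard_eq (G : SimpleGraph V) :
    ∃ f, IsMate G f ∧ {x | f x ≠ x}.ncard = 2 * matchingNumber G := by
  obtain ⟨M, hM, hMn⟩ := exists_isMatching_matchingNumber G
  obtain ⟨f, hf, -, hfM⟩ := exists_isMate_of_isMatching hM
  refine ⟨f, hf, ?_⟩
  rw [← hMn, ← ncard_verts_of_isMatching hM]
  congr 1
  ext x
  exact hfM x

theorem IsMate.allowedGraph_adj {f : V → V} (hf : IsMate G f)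
    (hfn : {x | f x ≠ x}.ncard = 2 * matchingNumber G) {a : V} (ha : f a ≠ a) :
    (allowedGraph G).Adj a (f a) := by
  refine ⟨hf.subgraph, ⟨hf.isMatching_subgraph, fun N hN ↦ ?_⟩, rfl, ha.symm⟩
  have h1 := ncard_verts_of_isMatching hf.isMatching_subgraph
  have h2 : N.edgeSet.ncard ≤ matchingNumber G := le_csSup (bddAbove_matching G) ⟨_, hN, rfl⟩
  have h3 : {x | f x ≠ x} = hf.subgraph.verts := rfl
  rw [h3] at hfn
  omega

theorem exists_isMate_of_allowedGraph_adj {a b : V} (h : (allowedGraph G).Adj a b) :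
    ∃ f, IsMate G f ∧ {x | f x ≠ x}.ncard = 2 * matchingNumber G ∧ f a = b := by
  obtain ⟨M, ⟨hM, hmax⟩, hab⟩ := h
  obtain ⟨f, hf, hfadj, hfM⟩ := exists_isMate_of_isMatching hM
  refine ⟨f, hf, le_antisymm hf.ncard_le ?_, hfadj a b hab⟩
  obtain ⟨N, hN, hNn⟩ := exists_isMatching_matchingNumber G
  have h1 := hmax N hN
  have h2 : {x | f x ≠ x} = M.verts := Set.ext hfM
  rw [h2, ncard_verts_of_isMatching hM]
  omega

theorem ncard_fixed {f : V → V} {n : ℕ} (hfn : {x | f x ≠ x}.ncard = n) :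
    {x | f x = x}.ncard = Nat.card V - n := by
  have h : {x | f x = x} = {x | f x ≠ x}ᶜ := by ext x; simp
  rw [h, Set.ncard_compl, hfn]

/-- If deleting `u` and `v` does not increase the deficiency, then a matching with at least
`ν(G) - 1` edges misses `u` and `v`. -/
theorem exists_isMate_of_deficiency_le {u v : V} (huv : u ≠ v)
    (h : deficiency (G.induce ({u, v} : Set V)ᶜ) ≤ deficiency G) :
    ∃ f, IsMate G f ∧ f u = u ∧ f v = v ∧
      2 * matchingNumber G ≤ {x | f x ≠ x}.ncard + 2 := by
  obtain ⟨g, hg, hgn⟩ := exists_isMate_ncard_eq (G.induce ({u, v} : Set V)ᶜ)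
  obtain ⟨f, hf, h1, h2⟩ := exists_isMate_of_rel (Γ := G)
    (fun a b ↦ ∃ a' b' : ↥({u, v} : Set V)ᶜ, a'.1 = a ∧ b'.1 = b ∧ g a' = b' ∧ a' ≠ b')
    (by
      rintro _ _ ⟨a, b, rfl, rfl, rfl, h⟩
      exact ⟨_, _, rfl, rfl, (hg a).1, h.symm⟩)
    (by
      rintro _ _ ⟨a, b, rfl, rfl, rfl, h⟩
      exact (hg a).2.resolve_left h.symm)
    (by
      rintro _ _ _ ⟨a, b, rfl, rfl, rfl, h⟩ ⟨a', b', h1, rfl, rfl, h'⟩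
      rw [Subtype.ext h1])
  refine ⟨f, hf, ?_, ?_, ?_⟩
  · by_contra hu
    obtain ⟨_, a', _, h3, -⟩ := (h2 u).1 hu
    exact a'.2 (by simp [h3])
  · by_contra hv
    obtain ⟨_, a', _, h3, -⟩ := (h2 v).1 hv
    exact a'.2 (by simp [h3])
  · have h3 : {x | f x ≠ x} = Subtype.val '' {x | g x ≠ x} := by
      ext x
      simp only [Set.mem_ofPred_eq, h2, Set.mem_image]
      constructor
      · rintro ⟨_, a, b, rfl, rfl, rfl, h⟩
        exact ⟨a, h.symm, rfl⟩
      · rintro ⟨a, h, rfl⟩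
        exact ⟨_, a, g a, rfl, rfl, rfl, Ne.symm h⟩
    rw [h3, Set.ncard_image_of_injective _ Subtype.val_injective, hgn]
    have h4 : Nat.card ↥({u, v} : Set V)ᶜ = Nat.card V - 2 := by
      rw [Nat.card_coe_set_eq, Set.ncard_compl, Set.ncard_pair huv]
    have h5 : 2 ≤ Nat.card V := by
      rw [← Set.ncard_pair huv]
      exact Set.ncard_le_card _
    rw [deficiency, deficiency, h4] at h
    omega

/-- The `d` new vertices can be matched to the `d` vertices outside `S` that `f` misses. -/
theorem IsMate.matchable_extension {d : ℕ} {f : V → V} (hf : IsMate G f) {S : Set V}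
    (hS : ∀ x ∈ S, f x = x) (hd : {x | f x = x ∧ x ∉ S}.ncard = d) :
    Matchable (extension G d) (Set.univ \ Sum.inl '' S) := by
  have e : {x | f x = x ∧ x ∉ S} ≃ Fin d := by
    rw [← hd, ← Nat.card_coe_set_eq]
    exact Finite.equivFin _
  refine Matchable.of_rel (fun
    | .inl a, .inl b => f a = b ∧ a ≠ b
    | .inl a, .inr i => (e.symm i).1 = a
    | .inr i, .inl a => (e.symm i).1 = a
    | .inr _, .inr _ => False) ?_ ?_ ?_ ?_
  · rintro (a | i) (b | j) h
    · obtain ⟨rfl, h⟩ := h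
      exact ⟨(hf a).1, h.symm⟩
    · exact h
    · exact h
    · exact h
  · rintro (a | i) (b | j) h
    · obtain ⟨rfl, h⟩ := h
      exact (hf a).2.resolve_left h.symm
    · trivial
    · trivial
    · exact h
  · rintro (a | i) (b | j) (c | k) h h'
    · rw [← h.1, ← h'.1]
    · obtain ⟨rfl, h⟩ := h
      exact absurd ((h' ▸ (e.symm k).2).1 : f a = a) h.symm
    · obtain ⟨rfl, h'⟩ := h'
      exact absurd ((h ▸ (e.symm j).2).1 : f a = a) h'.symm
    · have : e.symm j = e.symm k := Subtype.ext (h.trans h'.symm)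
      rw [e.symm.injective this]
    · exact congrArg Sum.inl (h.symm.trans h')
    · exact h'.elim
    · exact h.elim
    · exact h.elim
  · rintro (a | i)
    · simp only [Set.mem_sdiff, Set.mem_univ, true_and, Set.mem_image, Sum.inl.injEq,
        exists_eq_right]
      constructor
      · intro ha
        by_cases h : f a = a
        · exact ⟨.inr (e ⟨a, h, ha⟩), by simp⟩
        · exact ⟨.inl (f a), rfl, Ne.symm h⟩
      · rintro ⟨b | j, h⟩ ha
        · exact h.2 ((hS a ha).symm.trans h.1)
        · exact (h ▸ (e.symm j).2.2 : a ∉ S) ha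
    · simp only [Set.mem_sdiff, Set.mem_univ, true_and, Set.mem_image, reduceCtorEq, and_false,
        exists_false, not_false_eq_true, true_iff]
      exact ⟨.inl (e.symm i).1, rfl⟩

/-- A perfect matching of the extension of `G` by `d = def(G)` vertices restricts to a maximum
matching of `G`. -/
theorem IsMate.exists_of_extension {d : ℕ} (hd : d = Nat.card V - 2 * matchingNumber G)
    {h : V ⊕ Fin d → V ⊕ Fin d} (hh : IsMate (extension G d) h) (hp : ∀ x, h x ≠ x) :
    ∃ f, IsMate G f ∧ {x | f x ≠ x}.ncard = 2 * matchingNumber G ∧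
      (∀ a b, h (.inl a) = .inl b → f a = b ∧ a ≠ b) ∧ ∀ a i, h (.inl a) = .inr i → f a = a := by
  obtain ⟨f, hf, h1, h2⟩ := exists_isMate_of_rel (Γ := G) (fun a b ↦ h (.inl a) = .inl b)
    (fun a b hab ↦ by rw [← hab]; exact (hh _).1)
    (fun a b hab ↦ by
      have := (hh (.inl a)).2.resolve_left (hp _)
      rwa [hab] at this)
    (fun a b c hab hac ↦ Sum.inl_injective (hab.symm.trans hac))
  have hinr : ∀ i, ∃ a, h (.inr i) = .inl a := by
    intro i
    have h3 := (hh (.inr i)).2.resolve_left (hp _)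
    rcases h4 : h (.inr i) with a | j
    · exact ⟨a, rfl⟩
    · rw [h4] at h3
      exact h3.elim
  choose k hk using hinr
  have hki : Function.Injective k := by
    intro i j hij
    have h3 := (hh (.inr i)).1
    rw [hk, hij, ← hk, (hh _).1] at h3
    exact (Sum.inr_injective h3).symm
  have hfix : ∀ a i, h (.inl a) = .inr i → f a = a := by
    intro a i hai
    by_contra hfa
    obtain ⟨b, hb⟩ := (h2 a).1 hfa
    rw [hai] at hb
    cases hb
  have h3 : {x | f x = x} = Set.range k := by
    ext a
    constructor
    · intro ha
      rcases h4 : h (.inl a) with b | i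
      · exact absurd ha ((h2 a).2 ⟨b, h4⟩)
      · refine ⟨i, ?_⟩
        have h5 := (hh (.inl a)).1
        rw [h4, hk] at h5
        exact Sum.inl_injective h5
    · rintro ⟨i, rfl⟩
      refine hfix _ i ?_
      rw [← hk, (hh _).1]
  refine ⟨f, hf, ?_, fun a b hab ↦ ⟨h1 a b hab, ?_⟩, hfix⟩
  · have h4 : {x | f x ≠ x} = {x | f x = x}ᶜ := rfl
    rw [h4, Set.ncard_compl, h3, ← Set.image_univ, Set.ncard_image_of_injective _ hki,
      Set.ncard_univ, Nat.card_fin, hd]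
    obtain ⟨g, hg, hgn⟩ := exists_isMate_ncard_eq G
    have := Set.ncard_le_card {x | g x ≠ x}
    omega
  · rintro rfl
    exact hp _ hab

end Deficiency

/-! ### Contractions, critical-inducing sets and the reduction -/

section Reduction

variable {V : Type*} {G : SimpleGraph V}

/-- The edges that a matching of the contraction `G[X] / X₀` has away from the contracted vertex
form a matching of `G`. -/
theorem matchable_of_contract {X X₀ S : Set V}
    {N : (contract (G.induce X) ((Subtype.val : ↥X → V) ⁻¹' X₀)).Subgraph} (hN : N.IsMatching)
    (hS : ∀ a, a ∈ S ↔ ∃ a' b', a'.1.1 = a ∧ N.Adj (some a') (some b')) : Matchable G S := by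
  refine Matchable.of_rel (fun a b ↦ ∃ a' b', a'.1.1 = a ∧ b'.1.1 = b ∧ N.Adj (some a') (some b'))
    ?_ ?_ ?_ ?_
  · rintro _ _ ⟨a, b, rfl, rfl, h⟩
    exact ⟨b, a, rfl, rfl, h.symm⟩
  · rintro _ _ ⟨a, b, rfl, rfl, h⟩
    exact N.adj_sub h
  · rintro _ _ _ ⟨a, b, rfl, rfl, h⟩ ⟨a', b', h1, rfl, h'⟩
    obtain rfl : a' = a := Subtype.ext (Subtype.ext h1)
    rw [Option.some_injective _ (hN.eq_of_adj_left h h')]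
  · intro a
    rw [hS]
    constructor
    · rintro ⟨a', b', rfl, h⟩
      exact ⟨_, a', b', rfl, rfl, h⟩
    · rintro ⟨_, a', b', rfl, rfl, h⟩
      exact ⟨a', b', rfl, h⟩

theorem matchable_of_isFactorCritical {X X₀ : Set V}
    (h : IsFactorCritical (contract (G.induce X) ((Subtype.val : ↥X → V) ⁻¹' X₀))) :
    Matchable G (X \ X₀) := by
  obtain ⟨N, hN, hNv⟩ := h none
  refine matchable_of_contract hN fun a ↦ ⟨fun ha ↦ ?_, ?_⟩
  · have h1 : (some ⟨⟨a, ha.1⟩, ha.2⟩ : Option ↥((Subtype.val : ↥X → V) ⁻¹' X₀)ᶜ) ∈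
        N.verts := by
      rw [hNv]; simp
    obtain ⟨b, hb, -⟩ := hN h1
    have h2 := N.edge_vert hb.symm
    rcases b with _ | b
    · rw [hNv] at h2
      simp at h2
    · exact ⟨_, b, rfl, hb⟩
  · rintro ⟨a', b', rfl, h⟩
    exact ⟨a'.1.2, a'.2⟩

theorem exists_matchable_of_isFactorCritical {X X₀ : Set V}
    (h : IsFactorCritical (contract (G.induce X) ((Subtype.val : ↥X → V) ⁻¹' X₀)))
    {w : V} (hw : w ∈ X \ X₀) :
    ∃ z ∈ X \ X₀, z ≠ w ∧ (∃ x ∈ X₀, G.Adj x z) ∧ Matchable G ((X \ X₀) \ {w, z}) := by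
  -- `z` is the vertex matched to the contracted vertex by the matching that misses `w` only
  obtain ⟨N, hN, hNv⟩ := h (some ⟨⟨w, hw.1⟩, hw.2⟩)
  have h1 : (none : Option ↥((Subtype.val : ↥X → V) ⁻¹' X₀)ᶜ) ∈ N.verts := by
    rw [hNv]; simp
  obtain ⟨z, hz, -⟩ := hN h1
  rcases z with _ | z
  · exact (N.adj_sub hz).elim
  have hzw : z.1.1 ≠ w := by
    rintro rfl
    have := N.edge_vert hz.symm
    rw [hNv] at this
    exact this rfl
  obtain ⟨x, hx, hxz⟩ := N.adj_sub hz
  refine ⟨z.1.1, ⟨z.1.2, z.2⟩, hzw, ⟨x.1, hx, hxz⟩, matchable_of_contract hN fun a ↦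
    ⟨fun ha ↦ ?_, ?_⟩⟩
  · have h2 : (some ⟨⟨a, ha.1.1⟩, ha.1.2⟩ : Option ↥((Subtype.val : ↥X → V) ⁻¹' X₀)ᶜ) ∈
        N.verts := by
      rw [hNv]
      simp only [Set.mem_compl_iff, Set.mem_singleton_iff, Option.some.injEq, Subtype.mk.injEq]
      exact fun h ↦ ha.2 (Or.inl h)
    obtain ⟨b, hb, -⟩ := hN h2
    rcases b with _ | b
    · have h3 := Option.some_injective _ (hN.eq_of_adj_left hz hb.symm)
      exact absurd (Or.inr (by rw [h3]; rfl)) ha.2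
    · exact ⟨_, b, rfl, hb⟩
  · rintro ⟨a, b, rfl, hab⟩
    refine ⟨⟨a.1.2, a.2⟩, ?_⟩
    rintro (h2 | h2)
    · have := N.edge_vert hab
      rw [hNv] at this
      exact this (congrArg some (Subtype.ext (Subtype.ext h2)))
    · obtain rfl : a = z := Subtype.ext (Subtype.ext h2)
      have := hN.eq_of_adj_left hab hz.symm
      simp at this

theorem IsCriticalInducing.mem_of_adj {H : FactorComponent G} {X : Set V}
    (hX : IsCriticalInducing G H X) :
    ∀ x ∈ X \ H.supp, ∀ y, (allowedGraph G).Adj x y → y ∈ X \ H.supp := by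
  obtain ⟨⟨S, -, rfl⟩, -, -⟩ := hX
  rintro x ⟨hx, hxH⟩ y hxy
  have hc : ∀ C : FactorComponent G, x ∈ C.supp ↔ y ∈ C.supp := fun C ↦
    SimpleGraph.ConnectedComponent.mem_supp_congr_adj C hxy
  refine ⟨?_, fun h ↦ hxH ((hc H).2 h)⟩
  simp only [Set.mem_iUnion] at hx ⊢
  obtain ⟨C, hC, hxC⟩ := hx
  exact ⟨C, hC, (hc C).1 hxC⟩

variable [Finite V]

theorem matchingNumber_pos_of_adj {a b : V} (h : G.Adj a b) : 0 < matchingNumber G := by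
  classical
  have hf : IsMate G id := fun x ↦ ⟨rfl, Or.inl rfl⟩
  have h1 := (hf.addEdge h rfl rfl).ncard_le
  have h2 : 0 < {x | (if x = a then b else if x = b then a else id x) ≠ x}.ncard := by
    rw [Set.ncard_pos]
    exact ⟨a, by simpa using h.ne'⟩
  have h3 := h2.trans_le h1
  omega

theorem exists_perfect_extension {d : ℕ} (hd : d = Nat.card V - 2 * matchingNumber G) :
    ∃ M, IsMate (extension G d) M ∧ ∀ x, M x ≠ x := by
  obtain ⟨f, hf, hfn⟩ := exists_isMate_ncard_eq G
  obtain ⟨M, hM, hMS⟩ := hf.matchable_extension (S := ∅) (d := d) (by simp)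
    (by simpa [hd] using ncard_fixed hfn)
  exact ⟨M, hM, fun x ↦ (hMS x).2 (by simp)⟩

theorem IsMate.matchable_extension_diff {d : ℕ} (hd : d = Nat.card V - 2 * matchingNumber G)
    {f : V → V} (hf : IsMate G f) (hfn : {x | f x ≠ x}.ncard = 2 * matchingNumber G) {a b : V}
    (hab : f a = b) (hne : a ≠ b) :
    Matchable (extension G d) (Set.univ \ {.inl a, .inl b}) := by
  obtain ⟨g, hg, hgS⟩ := hf.matchable_diff_edge (S := {x | f x ≠ x}) (fun x ↦ Iff.rfl) a
  subst hab
  have hgS' : ∀ x, g x = x ↔ f x = x ∨ x = a ∨ x = f a := by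
    intro x
    have := hgS x
    grind
  have := hg.matchable_extension (S := {a, f a}) (d := d) (fun x hx ↦ (hgS' x).2 (Or.inr hx)) ?_
  · rwa [Set.image_pair] at this
  · rw [hd, ← ncard_fixed hfn]
    congr 1
    ext x
    have := hgS' x
    have := (hf a).1
    grind

theorem IsAllowed.of_allowedGraph_adj {d : ℕ} (hd : d = Nat.card V - 2 * matchingNumber G)
    {a b : V} (h : (allowedGraph G).Adj a b) :
    IsAllowed (extension G d) Set.univ (.inl a) (.inl b) := by
  obtain ⟨f, hf, hfn, hab⟩ := exists_isMate_of_allowedGraph_adj h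
  have hadj : G.Adj a b := by
    have := (hf a).2.resolve_left (by rw [hab]; exact h.ne')
    rwa [hab] at this
  exact ⟨trivial, trivial, hadj, hf.matchable_extension_diff hd hfn hab h.ne⟩

/-- If deleting `u` and `v` does not increase the deficiency, then it leaves a perfect matching in
the extension. -/
theorem matchable_of_deficiency_le {d : ℕ} (hd : d = Nat.card V - 2 * matchingNumber G)
    (hν : 0 < matchingNumber G) {u v : V} (huv : u ≠ v)
    (h : deficiency (G.induce ({u, v} : Set V)ᶜ) ≤ deficiency G) :
    Matchable (extension G d) (Set.univ \ {.inl u, .inl v}) := by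
  obtain ⟨f, hf, hu, hv, hfn⟩ := exists_isMate_of_deficiency_le huv h
  have hle := hf.ncard_le
  have heven : Even {x | f x ≠ x}.ncard := by
    have : {x | f x ≠ x} = hf.subgraph.verts := rfl
    rw [this, ncard_verts_of_isMatching hf.isMatching_subgraph]
    exact even_two_mul _
  have hsub : ∀ g : V → V, IsMate G g → g u = u → g v = v →
      {x | g x ≠ x}.ncard + 2 = 2 * matchingNumber G →
      Matchable (extension G d) (Set.univ \ {.inl u, .inl v}) := by
    intro g hg hgu hgv hgn
    have := hg.matchable_extension (S := {u, v}) (d := d) (by simp [hgu, hgv]) ?_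
    · rwa [Set.image_pair] at this
    · have h1 : {x | g x = x ∧ x ∉ ({u, v} : Set V)} = {x | g x = x} \ {u, v} := rfl
      obtain ⟨m, hm, hmn⟩ := exists_isMate_ncard_eq G
      have h2 := Set.ncard_le_card {x | m x ≠ x}
      have h3 : ({u, v} : Set V) ⊆ {x | g x = x} := by
        rintro x (rfl | rfl)
        · exact hgu
        · exact hgv
      rw [h1, Set.ncard_sdiff h3, ncard_fixed rfl, Set.ncard_pair huv]
      omega
  by_cases hfn' : {x | f x ≠ x}.ncard + 2 = 2 * matchingNumber G
  · exact hsub f hf hu hv hfn'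
  -- the matching is maximum, and one of its edges is deleted
  have hfn'' : {x | f x ≠ x}.ncard = 2 * matchingNumber G := by
    obtain ⟨k, hk⟩ := heven
    omega
  obtain ⟨a, ha⟩ : {x | f x ≠ x}.Nonempty := by
    rw [← Set.ncard_pos]
    omega
  obtain ⟨g, hg, hgS⟩ := hf.matchable_diff_edge (S := {x | f x ≠ x}) (fun x ↦ Iff.rfl) a
  refine hsub g hg ?_ ?_ ?_
  · have := hgS u
    grind
  · have := hgS v
    grind
  · have h1 : {x | g x ≠ x} = {x | f x ≠ x} \ {a, f a} := Set.ext hgS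
    have h3 : ({a, f a} : Set V) ⊆ {x | f x ≠ x} := by
      rintro x (rfl | rfl)
      · exact ha
      · have := (hf a).1
        exact fun h ↦ ha (by rw [← h, this])
    rw [h1, Set.ncard_sdiff h3, hfn'', Set.ncard_pair (Ne.symm ha)]
    omega

/-- In a critical-inducing set `X` for `H`, no maximum matching of `G` misses a vertex outside `H`,
because `X \ V(H)` is a union of factor-components with a perfect matching of its own. -/
theorem IsMate.ne_of_isCriticalInducing {H : FactorComponent G} {X : Set V}
    (hX : ∀ x ∈ X \ H.supp, ∀ y, (allowedGraph G).Adj x y → y ∈ X \ H.supp)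
    (hm : Matchable G (X \ H.supp)) {f : V → V} (hf : IsMate G f)
    (hfn : {x | f x ≠ x}.ncard = 2 * matchingNumber G) {x : V} (hx : x ∈ X \ H.supp) :
    f x ≠ x := by
  intro hfx
  have hcl : ∀ y ∈ X \ H.supp, f y ∈ X \ H.supp := by
    intro y hy
    by_cases hfy : f y = y
    · rwa [hfy]
    · exact hX y hy _ (hf.allowedGraph_adj hfn hfy)
  have h1 : Matchable G {y | y ∉ X \ H.supp ∧ f y ≠ y} :=
    hf.matchable_of_mapsTo (hf.mapsTo_compl hcl) fun y ↦ Iff.rfl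
  obtain ⟨g, hg, hgS⟩ := h1.union hm (fun y hy ↦ hy.1)
  refine (hg.ncard_le).not_gt ?_
  rw [← hfn]
  refine Set.ncard_lt_ncard ⟨fun y hy ↦ ?_, fun h ↦ ?_⟩ (Set.toFinite _)
  · refine (hgS y).2 ?_
    by_cases h : y ∈ X \ H.supp
    · exact Or.inr h
    · exact Or.inl ⟨h, hy⟩
  · exact h ((hgS x).2 (Or.inr hx)) hfx

/-- Critical-inducing sets of `G` give critical sets of the extension. -/
theorem IsCriticalInducing.isCrit {d : ℕ} (hd : d = Nat.card V - 2 * matchingNumber G)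
    {M : V ⊕ Fin d → V ⊕ Fin d} (hM : IsMate (extension G d) M) (hMp : ∀ x, M x ≠ x)
    {H : FactorComponent G} {X : Set V} (hX : IsCriticalInducing G H X) {g : V} (hg : g ∈ H.supp)
    {W₀ : Set (V ⊕ Fin d)} (hW₀ : ∀ x, x ∈ W₀ ↔
      Relation.ReflTransGen (IsAllowed (extension G d) Set.univ) (.inl g) x)
    (hHW₀ : ∀ x ∈ H.supp, .inl x ∈ W₀) :
    IsCrit (extension G d) M W₀ (Sum.inl '' (X \ H.supp)) := by
  have hadj := hX.mem_of_adj
  have hm := matchable_of_isFactorCritical hX.2.2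
  have hcl : ∀ N, IsMate (extension G d) N → (∀ x, N x ≠ x) →
      ∀ x ∈ Sum.inl '' (X \ H.supp), N x ∈ Sum.inl '' (X \ H.supp) := by
    rintro N hN hNp _ ⟨x, hx, rfl⟩
    obtain ⟨f, hf, hfn, hf1, hf2⟩ := hN.exists_of_extension hd hNp
    have hfx := hf.ne_of_isCriticalInducing hadj hm hfn hx
    rcases h : N (.inl x) with y | i
    · have := hadj x hx _ (hf.allowedGraph_adj hfn hfx)
      rw [(hf1 x y h).1] at this
      exact ⟨y, this, rfl⟩
    · exact absurd (hf2 x i h) hfx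
  refine ⟨fun x hx hxW ↦ ?_, hcl M hM hMp, ?_⟩
  · have : ∀ y, Relation.ReflTransGen (IsAllowed (extension G d) Set.univ) (.inl g) y →
        y ∉ Sum.inl '' (X \ H.supp) := by
      intro y hy
      induction hy with
      | refl =>
        rintro ⟨g', hg', h⟩
        exact hg'.2 (Sum.inl_injective h ▸ hg)
      | @tail a b _ hab ih =>
        intro hb
        obtain ⟨N, hN, hNp, rfl⟩ := hab.exists_isMate
        have := hcl N hN hNp _ hb
        rw [(hN a).1] at this
        exact ih this
    exact this x ((hW₀ x).1 hxW) hx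
  · rintro _ ⟨w, hw, rfl⟩
    obtain ⟨z, hz, hzw, ⟨x, hx, hxz⟩, hmz⟩ := exists_matchable_of_isFactorCritical hX.2.2 hw
    refine ⟨.inl z, ⟨z, hz, rfl⟩, fun h ↦ hzw (Sum.inl_injective h), ⟨.inl x, hHW₀ x hx, hxz⟩, ?_⟩
    have := hmz.image_inl (d := d)
    rwa [Set.image_sdiff Sum.inl_injective, Set.image_pair] at this

end Reduction

end Basilica

theorem mainTheorem3 {V : Type*} [Finite V] (G : SimpleGraph V)
    (G₀ : Basilica.FactorComponent G)
    (K : (G.induce (Basilica.strictUpperVerts G G₀)).ConnectedComponent) :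
    ∃ T ∈ Basilica.gklPartition G G₀,
      Basilica.neighbours G (Subtype.val '' K.supp) ∩ G₀.supp ⊆ T := by
  open Basilica in
  rcases (neighbours G (Subtype.val '' K.supp) ∩ G₀.supp).eq_empty_or_nonempty with hemp | ⟨u, hu⟩
  · obtain ⟨g, hg⟩ := G₀.nonempty_supp
    exact ⟨_, ⟨g, hg, rfl⟩, by simp [hemp]⟩
  refine ⟨_, ⟨u, hu.2, rfl⟩, fun v hv ↦ ?_⟩
  by_cases huv : u = v
  · exact Or.inl huv
  have hcomp : (allowedGraph G).connectedComponentMk u = (allowedGraph G).connectedComponentMk v :=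
    hu.2.trans hv.2.symm
  refine Or.inr ⟨hcomp, ?_⟩
  by_contra! hdef
  obtain ⟨⟨-, _, ⟨p, hpK, rfl⟩, hpu⟩, huG₀⟩ := hu
  obtain ⟨⟨-, _, ⟨q, hqK, rfl⟩, hqv⟩, hvG₀⟩ := hv
  obtain ⟨d, hd⟩ : ∃ d, d = Nat.card V - 2 * matchingNumber G := ⟨_, rfl⟩
  have hν : 0 < matchingNumber G := matchingNumber_pos_of_adj hpu
  obtain ⟨M, hM, hMp⟩ := exists_perfect_extension (G := G) hd
  -- the factor-component of the extension that contains `G₀`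
  obtain ⟨W₀, hW₀⟩ : ∃ W₀ : Set (V ⊕ Fin d), ∀ x, x ∈ W₀ ↔
      Relation.ReflTransGen (IsAllowed (extension G d) Set.univ) (.inl u) x :=
    ⟨{x | _}, fun _ ↦ Iff.rfl⟩
  have hsymm : ∀ {x y}, Relation.ReflTransGen (IsAllowed (extension G d) Set.univ) x y →
      Relation.ReflTransGen (IsAllowed (extension G d) Set.univ) y x := by
    intro x y h
    induction h with
    | refl => exact .refl
    | tail _ h ih => exact .head ⟨trivial, trivial, h.2.2.1.symm, by
        rw [Set.pair_comm]; exact h.2.2.2⟩ ih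
  have hHW₀ : ∀ x ∈ G₀.supp, .inl x ∈ W₀ := by
    intro x hx
    have h1 : (allowedGraph G).Reachable u x :=
      SimpleGraph.ConnectedComponent.exact (huG₀.trans hx.symm)
    rw [SimpleGraph.reachable_iff_reflTransGen] at h1
    exact (hW₀ _).2 (h1.lift Sum.inl fun a b h ↦ IsAllowed.of_allowedGraph_adj hd h)
  have hU : ∀ x ∈ strictUpperVerts G G₀, .inl x ∈ maxCrit (extension G d) M W₀ := by
    intro x hx
    simp only [strictUpperVerts, Set.mem_iUnion] at hx
    obtain ⟨H, ⟨⟨X, hX, hHX⟩, hne⟩, hxH⟩ := hx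
    exact ⟨_, hX.isCrit hd hM hMp huG₀ hW₀ hHW₀, x,
      ⟨hHX hxH, fun h ↦ hne (hxH.symm.trans h)⟩, rfl⟩
  have hpq : Relation.ReflTransGen (fun x y ↦ (extension G d).Adj x y ∧
      x ∈ maxCrit (extension G d) M W₀ ∧ y ∈ maxCrit (extension G d) M W₀)
      (.inl p.1) (.inl q.1) := by
    have h1 := SimpleGraph.ConnectedComponent.exact (hpK.trans hqK.symm)
    rw [SimpleGraph.reachable_iff_reflTransGen] at h1
    refine h1.lift (fun x ↦ Sum.inl x.1) ?_
    intro a b h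
    exact ⟨h, hU _ a.2, hU _ b.2⟩
  refine not_matchable_of_reachable (W₀ := W₀) hM hMp
    (fun x hx y hxy ↦ (hW₀ y).2 (((hW₀ x).1 hx).tail hxy))
    (fun x hx y hy ↦ (hsymm ((hW₀ x).1 hx)).trans ((hW₀ y).1 hy))
    (hHW₀ u huG₀) (hHW₀ v hvG₀) (fun h ↦ huv (Sum.inl_injective h)) (hU _ p.2) hpq
    (show G.Adj u p.1 from hpu.symm) (show G.Adj v q.1 from hqv.symm)
    (matchable_of_deficiency_le hd hν huv hdef)
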